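/- Conventions. A category is *coherent* if it is regular (finite limits, effective epi--mono factorizations, effective epimorphisms stable under pullback) and its subobject posets have finite unions (including the empty one) that are stable under pullback. For a regular cardinal $\lambda$, it is *$\lambda$-geometric* if it is regular and has pullback-stable unions of fewer than $\lambda$ subobjects. A *coherent functor* preserves finite limits, effective epimorphisms and finite unions of subobjects (including the empty one). A *$\lambda$-pretopos* is a $\lambda$-geometric category with disjoint coproducts of size $<\lambda$ in which every internal equivalence relation is a kernel pair. Let $\lambda\ge\kappa\ge\aleph_0$ be regular cardinals. A *$(\lambda,\kappa)$-tree* is a rooted tree $P$ (possibly of transfinite height, a vertex at a limit level being determined by its predecessors) in which each vertex has $<\lambda$ immediate successors and each branch (maximal chain) has length $<\kappa$. A diagram $F:P^{op}\to\mathcal D$ is *proper* if for each non-leaf vertex $p$ the maps $F(q)\to F(p)$, $q$ an immediate successor of $p$, form an effective epimorphic family, and $F(p)=\lim_{q<p}F(q)$ for each $p$ at a limit level. It is *completely proper* if moreover the maps $\lim_{q\in b}F(q)\to F(\mathrm{root})$, $b$ ranging over the branches, form an effective epimorphic family. A *$(\lambda,\kappa)$-pretopos* is a $\lambda$-pretopos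 with all limits of size $<\kappa$, in which, in every $\mathrm{Sub}(x)$, meets of size $<\kappa$ distribute over joins of size $<\lambda$, and in which every proper diagram on a $(\lambda,\kappa)$-tree is completely proper. A coherent category is *weakly Boolean* if for all subobjects $a,b$ of an object $x$ either $a\le b$ or there is a subobject $\emptyset\ne u\le a$ with $u\cap b=\emptyset$. For an ultrafilter $U$ on a set $I$ and objects $(X_i)_{i\in I}$ of a category, the *ultraproduct* is $\prod_i X_i/U=\operatorname{colim}_{J\in U}\prod_{i\in J}X_i$, the colimit being taken along the projections over $J\in U$ ordered by reverse inclusion. **Theorem.** Let $\lambda\ge\kappa\ge\aleph_0$ be regular cardinals such that $2^\gamma<\lambda$ for every cardinal $\gamma<\kappa$. Let $\mathcal D$ be a weakly Boolean $(\lambda,\kappa)$-pretopos in which $\{0\}\subseteq\mathrm{Sub}_{\mathcal D}(1)$ is a $\kappa$-prime ideal, i.e. if an intersection of fewer than $\kappa$ subobjects of $1$ is $0$, then one of them is $0$. Let $I$ be a set with $|I|<\kappa$ and $U$ an ultrafilter on $I$. Then ultraproducts along $U$ exist in $\mathcal D$, and: 1. For every coherent category $\mathcal C$, ultraproducts along $U$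 exist in the functor category $\mathcal D^{\mathcal C}$, and if $F_i:\mathcal C\to\mathcal D$ $(i\in I)$ are coherent functors, then $\prod_iF_i/U$ is a coherent functor. That is, $\mathbf{Coh}(\mathcal C,\mathcal D)$ is closed under $<\kappa$-ultraproducts in $\mathcal D^{\mathcal C}$. 2. For all families of subobjects $A_i\hookrightarrow X_i\hookleftarrow B_i$ $(i\in I)$ in $\mathcal D$, the induced maps $\prod_iA_i/U\to\prod_iX_i/U$ and $\prod_iB_i/U\to\prod_iX_i/U$ are monomorphisms, and, as subobjects of $\prod_iX_i/U$, $$\prod_iA_i/U\ \le\ \prod_iB_i/U\quad\Longleftrightarrow\quad\{i\in I: A_i\le B_i\}\in U.$$ -/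

import Mathlib

open CategoryTheory CategoryTheory.Limits Opposite

universe w u v u' v'

/-! ## Geometric and coherent categories, coherent functors -/

/-- A regular category is `lam`-geometric if each subobject poset has unions (least upper bounds)
of families of size `< lam`, and these unions are stable under pullback. -/
structure IsGeometricCategory (lam : Cardinal.{w}) (C : Type u) [Category.{v} C] [Regular C] :
    Prop where
  exists_isLUB : ∀ {X : C} {ι : Type w} (a : ι → Subobject X), Cardinal.mk ι < lam →
    ∃ s : Subobject X, IsLUB (Set.range a) s
  isLUB_pullback : ∀ {X Y : C} (f : Y ⟶ X) {ι : Type w} (a : ι → Subobject X),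
    Cardinal.mk ι < lam → ∀ s : Subobject X, IsLUB (Set.range a) s →
      IsLUB (Set.range fun i => (Subobject.pullback f).obj (a i)) ((Subobject.pullback f).obj s)

/-- A coherent category: a regular category with pullback-stable finite unions of subobjects
(the empty union included). -/
def IsCoherentCategory (C : Type u) [Category.{v} C] [Regular C] : Prop :=
  IsGeometricCategory (Cardinal.aleph0.{0}) C

/-- A coherent functor preserves finite limits, effective epimorphisms (in a category with
pullbacks these are the regular epimorphisms) and finite unions of subobjects (the empty union
included). -/
structure IsCoherentFunctor {C : Type u} [Category.{v} C] {D : Type u'} [Category.{v'} D]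
    (F : C ⥤ D) : Prop where
  preservesFiniteLimits : PreservesFiniteLimits F
  map_isRegularEpi : ∀ {X Y : C} (f : X ⟶ Y), IsRegularEpi f → IsRegularEpi (F.map f)
  map_isLUB : ∀ {X : C} {ι : Type} [Finite ι] (a : ι → Subobject X) (s : Subobject X),
    IsLUB (Set.range a) s →
      IsLUB (Set.range fun i => Subobject.mk (F.map (a i).arrow)) (Subobject.mk (F.map s.arrow))

/-! ## Pretoposes -/

/-- `(p, q) : R ⇉ X` is an internal equivalence relation. -/
structure IsInternalEquivalence {C : Type u} [Category.{v} C] {R X : C} (p q : R ⟶ X) :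
    Prop where
  jointly_mono : ∀ {T : C} (a b : T ⟶ R), a ≫ p = b ≫ p → a ≫ q = b ≫ q → a = b
  refl : ∃ r : X ⟶ R, r ≫ p = 𝟙 X ∧ r ≫ q = 𝟙 X
  symm : ∃ s : R ⟶ R, s ≫ p = q ∧ s ≫ q = p
  trans : ∀ {T : C} (a b : T ⟶ R), a ≫ q = b ≫ p → ∃ c : T ⟶ R, c ≫ p = a ≫ p ∧ c ≫ q = b ≫ q

/-- A `lam`-pretopos: a `lam`-geometric category with disjoint coproducts of size `< lam` in which
every internal equivalence relation is effective, i.e. is a kernel pair.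
(Coproducts are then automatically stable under pullback, since unions are.) -/
structure IsGeometricPretopos (lam : Cardinal.{w}) (D : Type u) [Category.{v} D] [Regular D] :
    Prop extends IsGeometricCategory lam D where
  hasCoproducts : ∀ ι : Type w, Cardinal.mk ι < lam → HasCoproductsOfShape ι D
  disjoint : ∀ ι : Type w, Cardinal.mk ι < lam → CoproductsOfShapeDisjoint D ι
  effective : ∀ {R X : D} (p q : R ⟶ X), IsInternalEquivalence p q →
    ∃ (Q : D) (f : X ⟶ Q), IsKernelPair f p q

/-- `D` has limits of all diagrams with `< κ` arrows. -/
def HasLimitsLT (κ : Cardinal.{w}) (D : Type u) [Category.{v} D] : Prop :=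
  ∀ (J : Type w) [SmallCategory J], Cardinal.mk (Arrow J) < κ → HasLimitsOfShape J D

/-- In each subobject poset, meets of size `< κ` distribute over joins of size `< lam`:
`⋀ i, ⋁ j, a i j = ⋁ f, ⋀ i, a i (f i)`, where `f` runs over the choice functions. -/
def MeetsDistribute (lam κ : Cardinal.{w}) (D : Type u) [Category.{v} D] : Prop :=
  ∀ (X : D) (ι : Type w) (J : ι → Type w), Cardinal.mk ι < κ → (∀ i, Cardinal.mk (J i) < lam) →
    ∀ (a : ∀ i, J i → Subobject X) (b : ι → Subobject X) (m : Subobject X)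
      (c : (∀ i, J i) → Subobject X),
      (∀ i, IsLUB (Set.range (a i)) (b i)) → IsGLB (Set.range b) m →
      (∀ f, IsGLB (Set.range fun i => a i (f i)) (c f)) →
      IsLUB (Set.range c) m

/-! ## Trees and proper diagrams -/

/-- A rooted tree (a partial order with least element, the strict predecessors of each vertex
forming a well-ordered chain, a vertex at a limit level being determined by its predecessors),
such that each vertex has `< lam` immediate successors and each branch (maximal chain) has
length `< κ`. -/
structure IsBoundedTree (lam κ : Cardinal.{w}) (P : Type w) [PartialOrder P] [OrderBot P] :
    Prop where
  wellFounded : WellFoundedLT P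
  isChain : ∀ p : P, IsChain (· ≤ ·) (Set.Iio p)
  limit_unique : ∀ p q : P, Order.IsSuccLimit p → Set.Iio p = Set.Iio q → p = q
  degree : ∀ p : P, Cardinal.mk {q : P // p ⋖ q} < lam
  length : ∀ b : Flag P, Cardinal.mk b < κ

section Trees

variable {P : Type w} [PartialOrder P] {D : Type u} [Category.{v} D]

/-- The restriction of a diagram `F : Pᵒᵖ ⥤ D` to a subset of `P`. -/
def restrictDiagram (F : Pᵒᵖ ⥤ D) (S : Set P) : (↥S)ᵒᵖ ⥤ D :=
  (Subtype.mono_coe (· ∈ S)).functor.op ⋙ F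

/-- The cone over the restriction of `F` to `{q | q < p}` with vertex `F p`. -/
def coneBelow (F : Pᵒᵖ ⥤ D) (p : P) : Cone (restrictDiagram F (Set.Iio p)) where
  pt := F.obj (op p)
  π :=
    { app := fun q => F.map (homOfLE q.unop.2.le).op
      naturality := fun q r h => by
        dsimp [restrictDiagram]
        rw [Category.id_comp, ← F.map_comp]
        rfl }

/-- `F` is proper: the successors of each non-leaf vertex cover it, and on each branch the value
at a limit position is the limit of the preceding values. -/
structure IsProperDiagram (F : Pᵒᵖ ⥤ D) : Prop where
  covers : ∀ p : P, (∃ q, p ⋖ q) →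
    EffectiveEpiFamily (fun q : {q : P // p ⋖ q} => F.obj (op q.1))
      (fun q => F.map (homOfLE q.2.le).op)
  limits : ∀ p : P, Order.IsSuccLimit p → Nonempty (IsLimit (coneBelow F p))

/-- The transfinite cocompositions of the branches (the projections from the limit of `F` along
each branch to the value at the root) form an effective epimorphic family on the root. -/
def BranchesCover [OrderBot P] (F : Pᵒᵖ ⥤ D) : Prop :=
  ∀ c : (b : Flag P) → LimitCone (restrictDiagram F (b : Set P)),
    EffectiveEpiFamily (B := F.obj (op ⊥)) (fun b : Flag P => (c b).cone.pt)
      (fun b => (c b).cone.π.app (op ⟨⊥, b.bot_mem⟩))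

end Trees

/-- `(lam, κ)`-regularity: every proper diagram on a `(lam, κ)`-tree is completely proper. -/
def IsTreeRegular (lam κ : Cardinal.{w}) (D : Type u) [Category.{v} D] : Prop :=
  ∀ (P : Type w) [PartialOrder P] [OrderBot P], IsBoundedTree lam κ P →
    ∀ F : Pᵒᵖ ⥤ D, IsProperDiagram F → BranchesCover F

/-- A `(lam, κ)`-pretopos. -/
structure IsInfinitaryPretopos (lam κ : Cardinal.{w}) (D : Type u) [Category.{v} D] [Regular D] :
    Prop extends IsGeometricPretopos lam D where
  hasLimits : HasLimitsLT κ D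
  distrib : MeetsDistribute lam κ D
  treeRegular : IsTreeRegular lam κ D

/-- For subobjects `a, b` of the same object, either `a ≤ b` or some nonempty `u ≤ a` is disjoint
from `b`. -/
def WeaklyBoolean (D : Type u) [Category.{v} D] [Regular D] : Prop :=
  ∀ {X : D} (a b : Subobject X), a ≤ b ∨ ∃ u : Subobject X, ¬ IsBot u ∧ u ≤ a ∧ IsBot (u ⊓ b)

/-- `{0} ⊆ Sub(1)` is a `κ`-prime ideal: if an intersection of `< κ` subobjects of `1` is `0` then
one of them is `0`. -/
def ZeroIsPrime (κ : Cardinal.{w}) (D : Type u) [Category.{v} D] [Regular D] : Prop :=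
  ∀ (ι : Type w) (a : ι → Subobject (⊤_ D)), Cardinal.mk ι < κ →
    ∀ m : Subobject (⊤_ D), IsGLB (Set.range a) m → IsBot m → ∃ i, IsBot (a i)

/-! ## Ultraproducts -/

section Ultraproducts

variable {I : Type w} (U : Ultrafilter I) {E : Type u} [Category.{v} E]

/-- The diagram `J ↦ ∏ i ∈ J, X i` on the sets `J ∈ U` ordered by reverse inclusion, with the
projections as transition maps. -/
noncomputable def ultraproductDiagram [∀ J : Set I, HasProductsOfShape J E] (X : I → E) :
    {J : Set I // J ∈ U}ᵒᵖ ⥤ E where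
  obj J := ∏ᶜ fun i : J.unop.1 => X i
  map {J K} h := Pi.lift fun i : K.unop.1 =>
    Pi.π (fun i : J.unop.1 => X i) ⟨i.1, leOfHom h.unop i.2⟩
  map_id J := by
    apply Pi.hom_ext
    intro i
    simp
  map_comp f g := by
    apply Pi.hom_ext
    intro i
    simp

variable (E) in
/-- The category `E` has all ultraproducts along the ultrafilter `U`, where
`(∏ i, X i) / U = colim (J ∈ U), ∏ i ∈ J, X i`. -/
class HasUltraproducts : Prop where
  hasProducts : ∀ J : Set I, HasProductsOfShape J E
  hasColimit : ∀ X : I → E, HasColimit (ultraproductDiagram U X)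

attribute [instance] HasUltraproducts.hasColimit

/-- The ultraproduct `(∏ i, X i) / U`. -/
noncomputable def ultraproduct [h : HasUltraproducts U E] (X : I → E) : E :=
  haveI := h.hasProducts
  colimit (ultraproductDiagram U X)

/-- The natural transformation of ultraproduct diagrams induced by maps `X i ⟶ Y i`. -/
noncomputable def ultraproductDiagramMap [∀ J : Set I, HasProductsOfShape J E] {X Y : I → E}
    (f : ∀ i, X i ⟶ Y i) : ultraproductDiagram U X ⟶ ultraproductDiagram U Y where
  app J := Limits.Pi.map fun i : J.unop.1 => f i
  naturality J K h := by
    apply Pi.hom_ext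
    intro i
    simp [ultraproductDiagram]

/-- The map of ultraproducts induced by maps `X i ⟶ Y i`. -/
noncomputable def ultraproductMap [h : HasUltraproducts U E] {X Y : I → E}
    (f : ∀ i, X i ⟶ Y i) : ultraproduct U X ⟶ ultraproduct U Y :=
  haveI := h.hasProducts
  colimMap (ultraproductDiagramMap U f)

end Ultraproducts

/-! ## The topology of universally extremal sieves -/

section Locally

variable {D : Type u} [Category.{v} D] [HasFiniteLimits D]

/-! This is Łoś's theorem, argued with generalized elements of `D`. A covering sieve is one no
pullback of which factors through a proper subobject. Existential statements are only required
`Locally`, that is, on a covering sieve. Regular epimorphisms and unions of fewer than `lam`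
subobjects supply such covers. Equality of maps and membership in a subobject can be checked on one.

As `|I| < κ`, the ultrafilter has at most `2 ^ |I| < lam` members, so the colimit defining an
ultraproduct is a quotient of a disjoint coproduct of admissible size by an effective equivalence
relation (`exists_isLocalColimit`). It is therefore computed as in sets. A generalized element is
locally a family defined on a member of `U`, and two families are equal exactly when locally they
agree on a member of `U`. `UltraPresentation` records this, and the Łoś arguments use nothing else
about ultraproducts.

Finite limits are preserved because `U` is closed under finite intersections. For regular
epimorphisms a whole family must be lifted at once. This needs products of fewer than `κ` regular
epimorphisms to be regular epimorphisms (`isRegularEpi_piMap`), and tree regularity along a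
well-ordered chain plays the part of dependent choice. For finite unions, distributivity turns a
family of disjunctions into one disjunction over choice functions, fewer than `lam` by the
hypothesis on powers. The ultrafilter then makes a choice function constant on a member
(`locally_exists_factors`).

For part 2, if `A i ≤ B i` fails on a member of `U`, weak Boolean-ness gives there nonempty `u i ≤ A
i` disjoint from `B i`. An inclusion of ultraproducts would make `∏ u i` empty, so by primeness of
zero some `u i` would be empty (`mem_of_mk_le_mk`). -/

theorem factors_of_pullback_eq_top {T X : D} {t : T ⟶ X} {R : Subobject X}
    (h : (Subobject.pullback t).obj R = ⊤) : R.Factors t := by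
  have := (Limits.pullback_factors_iff t R (𝟙 T)).1 (by rw [h]; exact Subobject.top_factors _)
  simpa only [Category.id_comp] using this

variable (D) in
/-- The Grothendieck topology whose covering sieves are those no pullback of which factors through a
proper subobject. -/
def extremalTopology : GrothendieckTopology D where
  sieves X := {S | ∀ ⦃Y : D⦄ (g : Y ⟶ X) (P : Subobject Y),
    (∀ ⦃A : D⦄ (f : A ⟶ Y), S (f ≫ g) → P.Factors f) → P = ⊤}
  top_mem' X Y g P h :=
    top_le_iff.mp (Subobject.le_of_factors (h _ trivial))
  pullback_stable' X Y S f hS Z g P h :=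
    hS (g ≫ f) P fun A k hk => h k (by simpa using hk)
  transitive' X S hS R hR Y g P h := by
    refine hS g P fun A f hf => ?_
    have := hR hf (𝟙 A) ((Subobject.pullback f).obj P) fun B k hk => by
      rw [Limits.pullback_factors_iff]
      exact h _ (by simpa using hk)
    exact factors_of_pullback_eq_top this

/-- The largest sieve contained in a class of arrows. -/
def sieveInside {T : D} (P : ∀ ⦃A : D⦄, (A ⟶ T) → Prop) : Sieve T where
  arrows _ f := ∀ ⦃B : D⦄ (g : B ⟶ _), P (g ≫ f)
  downward_closed h g B k := by simpa using h (k ≫ g)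

/-- `P` holds locally on `T` if it holds on all members of a covering sieve. -/
def Locally {T : D} (P : ∀ ⦃A : D⦄, (A ⟶ T) → Prop) : Prop :=
  sieveInside P ∈ extremalTopology D T

namespace Locally

variable {T : D} {P Q : ∀ ⦃A : D⦄, (A ⟶ T) → Prop}

theorem of_sieve {S : Sieve T} (hS : S ∈ extremalTopology D T)
    (h : ∀ ⦃A : D⦄ (f : A ⟶ T), S f → P f) : Locally P :=
  (extremalTopology D).superset_covering
    (fun _ _ hf _ g => h _ (S.downward_closed hf g)) hS

theorem of_forall (h : ∀ ⦃A : D⦄ (f : A ⟶ T), P f) : Locally P :=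
  of_sieve ((extremalTopology D).top_mem T) fun _ f _ => h f

theorem bind (hP : Locally P)
    (h : ∀ ⦃A : D⦄ (f : A ⟶ T), P f → Locally fun B (g : B ⟶ A) => Q (g ≫ f)) : Locally Q := by
  refine (extremalTopology D).transitive hP _ fun A f hf => ?_
  have hPf : P f := by simpa using hf (𝟙 A)
  exact (extremalTopology D).superset_covering
    (fun B g hg C k => by simpa only [Category.assoc] using hg k) (h f hPf)

theorem mono (hP : Locally P) (h : ∀ ⦃A : D⦄ (f : A ⟶ T), P f → Q f) : Locally Q :=
  of_sieve hP fun _ f hf => h f (by simpa using hf (𝟙 _))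

theorem pullback (hP : Locally P) {T' : D} (h : T' ⟶ T) :
    Locally fun A (f : A ⟶ T') => P (f ≫ h) :=
  of_sieve ((extremalTopology D).pullback_stable h hP)
    fun _ f hf => by simpa using hf (𝟙 _)

theorem of_extremal (h : ∀ ⦃Y : D⦄ (g : Y ⟶ T) (R : Subobject Y),
    (∀ ⦃A : D⦄ (f : A ⟶ Y), (∀ ⦃B : D⦄ (k : B ⟶ A), P (k ≫ f ≫ g)) → R.Factors f) → R = ⊤) :
    Locally P := h

theorem eq_top {R : Subobject T} (h : Locally fun A (f : A ⟶ T) => R.Factors f) : R = ⊤ :=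
  h (𝟙 T) R fun A f hf => by simpa using hf (𝟙 A)

/-- Pulling `R` back along `t` gives a subobject of `T` containing a covering sieve, and such a
subobject is everything. -/
theorem factors {X : D} {R : Subobject X} {t : T ⟶ X}
    (h : Locally fun A (f : A ⟶ T) => R.Factors (f ≫ t)) : R.Factors t := by
  have := eq_top (R := (Subobject.pullback t).obj R)
    (h.mono fun A f hf => (Limits.pullback_factors_iff _ _ _).2 hf)
  exact factors_of_pullback_eq_top this

theorem hom_ext {X : D} {a b : T ⟶ X} (h : Locally fun A (f : A ⟶ T) => f ≫ a = f ≫ b) :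
    a = b := by
  have := eq_top (R := equalizerSubobject a b)
    (h.mono fun A f hf => (equalizerSubobject_factors_iff _ _ _).2 hf)
  simpa only [Category.id_comp] using (equalizerSubobject_factors_iff a b (𝟙 T)).1
    (by rw [this]; exact Subobject.top_factors _)

/-- A lift through a monomorphism is membership in a subobject, so local lifts need no separate
gluing argument. -/
theorem exists_lift {X Y : D} {m : X ⟶ Y} [Mono m] {t : T ⟶ Y}
    (h : Locally fun A (f : A ⟶ T) => ∃ g : A ⟶ X, g ≫ m = f ≫ t) : ∃ g : T ⟶ X, g ≫ m = t :=
  (Subobject.mk_factors_iff m t).1 (factors (h.mono fun _ _ hf =>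
    (Subobject.mk_factors_iff m _).2 hf))

end Locally

theorem isIso_of_mono_of_locally {X Y : D} (m : X ⟶ Y) [Mono m]
    (h : Locally fun A (f : A ⟶ Y) => ∃ g : A ⟶ X, g ≫ m = f) : IsIso m := by
  obtain ⟨g, hg⟩ := Locally.exists_lift (m := m) (t := 𝟙 Y) (by simpa using h)
  exact ⟨g, by simp [← cancel_mono m, hg], hg⟩

/-- An object over which everything holds locally. -/
def IsLocallyEmpty (T : D) : Prop := ∀ P : ∀ ⦃A : D⦄, (A ⟶ T) → Prop, Locally P

theorem IsLocallyEmpty.factors {T X : D} (h : IsLocallyEmpty T) (t : T ⟶ X) (R : Subobject X) :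
    R.Factors t :=
  Locally.factors (h _)

theorem IsLocallyEmpty.of_locally {T : D} (h : Locally fun A (_ : A ⟶ T) => IsLocallyEmpty A) :
    IsLocallyEmpty T :=
  fun _ => h.bind fun _ _ hf => hf _

end Locally

/-! ### Regular epimorphisms and unions as covers -/

section Regular

variable {D : Type u} [Category.{v} D] [Regular D]

/-- The pullback of `e` along any map is again an extremal epimorphism, so no proper subobject
contains all the elements that lift. -/
theorem locally_of_isRegularEpi {X Y : D} (e : X ⟶ Y) [IsRegularEpi e] :
    Locally fun A (f : A ⟶ Y) => ∃ g : A ⟶ X, g ≫ e = f := by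
  refine .of_extremal fun T g P h => ?_
  have : P.Factors (pullback.snd e g) := h _ fun B k =>
    ⟨k ≫ pullback.fst e g, by simp [pullback.condition]⟩
  exact ExtremalEpi.subobject_eq_top _ this

theorem locally_lift_of_isRegularEpi {X Y T : D} (e : X ⟶ Y) [IsRegularEpi e] (t : T ⟶ Y) :
    Locally fun A (f : A ⟶ T) => ∃ g : A ⟶ X, g ≫ e = f ≫ t :=
  (locally_of_isRegularEpi e).pullback t

/-- If `e` factors through a monomorphism, the local lifts show that monomorphism to be invertible.
Thus `e` is extremal, which in a regular category means regular. -/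
theorem isRegularEpi_of_locally {X Y : D} (e : X ⟶ Y)
    (h : Locally fun A (f : A ⟶ Y) => ∃ g : A ⟶ X, g ≫ e = f) : IsRegularEpi e := by
  have : ExtremalEpi e := ExtremalEpi.mk_of_hasEqualizers e fun Z p i hi _ =>
    isIso_of_mono_of_locally i (h.mono fun A f ⟨g, hg⟩ => ⟨g ≫ p, by simp [hi, hg]⟩)
  infer_instance

variable {lam : Cardinal.{w}}

theorem IsGeometricCategory.locally_of_isLUB (hD : IsGeometricCategory lam D) {X T : D} {ι : Type w}
    (hι : Cardinal.mk ι < lam) {a : ι → Subobject X} {s : Subobject X}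
    (ha : IsLUB (Set.range a) s) (t : T ⟶ X) (ht : s.Factors t) :
    Locally fun A (f : A ⟶ T) => ∃ i, (a i).Factors (f ≫ t) := by
  refine .of_extremal fun Y g P h => ?_
  have h1 := hD.isLUB_pullback (g ≫ t) a hι s ha
  have h2 : (Subobject.pullback (g ≫ t)).obj s = ⊤ := by
    rw [← top_le_iff]
    apply Subobject.le_of_factors
    rw [Limits.pullback_factors_iff]
    exact Subobject.factors_of_factors_right _ (Subobject.factors_of_factors_right _ ht)
  rw [h2] at h1
  refine top_le_iff.mp (h1.2 ?_)
  rintro _ ⟨i, rfl⟩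
  refine Subobject.le_of_factors (h _ fun B k => ⟨i, ?_⟩)
  simp only [Category.assoc]
  exact Subobject.factors_of_factors_right _
    ((Limits.pullback_factors_iff _ _ _).1 (Subobject.factors_self _))

theorem IsGeometricCategory.isLocallyEmpty_of_isBot (hD : IsGeometricCategory lam D) (h0 : 0 < lam)
    {X T : D} {s : Subobject X} (hs : IsBot s) (t : T ⟶ X) (ht : s.Factors t) :
    IsLocallyEmpty T := by
  -- The bottom subobject is the empty union, so locally an index in the empty type exists.
  have := hD.locally_of_isLUB (ι := PEmpty.{w+1}) (by simpa using h0) (a := PEmpty.elim)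
    (s := s) ⟨by rintro _ ⟨⟨⟩, _⟩, fun b _ => hs b⟩ t ht
  exact fun P => this.mono fun _ _ ⟨i, _⟩ => i.elim

end Regular

/-! ## Filtered colimits in pretoposes -/

section FilteredColimits

variable {D : Type u} [Category.{v} D] [Regular D] {lam : Cardinal.{w}}

/-- The union of the images of a small family of maps. -/
theorem IsGeometricCategory.exists_union (hD : IsGeometricCategory lam D) {ι : Type w}
    (hι : Cardinal.mk ι < lam) {X : D} {Y : ι → D} (y : ∀ i, Y i ⟶ X) :
    ∃ S : Subobject X, (∀ i, S.Factors (y i)) ∧ ∀ ⦃T : D⦄ (t : T ⟶ X), S.Factors t →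
      Locally fun A (f : A ⟶ T) => ∃ (i : ι) (h : A ⟶ Y i), h ≫ y i = f ≫ t := by
  let F i := Regular.strongEpiMonoFactorisation (y i)
  obtain ⟨S, hS⟩ := hD.exists_isLUB (fun i => Subobject.mk (F i).m) hι
  refine ⟨S, fun i => ?_, fun T t ht => ?_⟩
  · refine Subobject.factors_of_le _ (hS.1 ⟨i, rfl⟩) ?_
    exact (Subobject.mk_factors_iff _ _).2 ⟨(F i).e, (F i).fac⟩
  · refine (hD.locally_of_isLUB hι hS t ht).bind fun A f ⟨i, hi⟩ => ?_
    obtain ⟨g, hg⟩ := (Subobject.mk_factors_iff _ _).1 hi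
    refine (locally_lift_of_isRegularEpi (F i).e g).mono fun B k ⟨h, hh⟩ => ⟨i, h, ?_⟩
    have hg' : g ≫ (F i).m = f ≫ t := hg
    exact (congrArg (h ≫ ·) (F i).fac.symm).trans <| ((reassoc_of% hh) (F i).m).trans <|
      (Category.assoc k g (F i).m).trans <| (congrArg (k ≫ ·) hg').trans (Category.assoc _ _ _).symm

theorem IsGeometricCategory.isLocallyEmpty_of_isInitial (hD : IsGeometricCategory lam D)
    (h0 : 0 < lam) {Z T : D} (hZ : IsInitial Z) (t : T ⟶ Z) : IsLocallyEmpty T := by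
  refine hD.isLocallyEmpty_of_isBot (X := Z) (s := ⊤) h0 (fun R => ?_) t (Subobject.top_factors _)
  apply Subobject.le_of_factors
  rw [Subobject.factors_iff]
  exact ⟨(⊤ : Subobject Z).arrow ≫ hZ.to _, (Category.assoc _ _ _).trans
    ((congrArg _ (hZ.hom_ext _ _)).trans (Category.comp_id _))⟩

/-! ### Generalized elements of disjoint coproducts -/

section Coproducts

variable (hD : IsGeometricPretopos lam D) {ι : Type w} (hι : Cardinal.mk ι < lam)
include hD hι

theorem IsGeometricPretopos.locally_lift_sigma (Y : ι → D) [HasCoproduct Y] {T : D} (t : T ⟶ ∐ Y) :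
    Locally fun A (f : A ⟶ T) => ∃ (i : ι) (a : A ⟶ Y i), a ≫ Sigma.ι Y i = f ≫ t := by
  obtain ⟨S, hS, hS'⟩ := hD.exists_union hι (Sigma.ι Y)
  refine hS' t ?_
  -- The union of the summands contains every injection, so its inclusion has a section and it is
  -- the whole coproduct.
  have : Sigma.desc (fun i => S.factorThru _ (hS i)) ≫ S.arrow = 𝟙 _ := by
    ext i
    simp
  exact (Subobject.factors_iff _ _).2 ⟨t ≫ Sigma.desc (fun i => S.factorThru _ (hS i)),
    (Category.assoc _ _ _).trans ((congrArg _ this).trans (Category.comp_id _))⟩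

theorem IsGeometricPretopos.isLocallyEmpty_of_sigma (h0 : 0 < lam) (Y : ι → D) [HasCoproduct Y]
    {T : D} {i j : ι} (hij : i ≠ j) (a : T ⟶ Y i) (b : T ⟶ Y j)
    (hab : a ≫ Sigma.ι Y i = b ≫ Sigma.ι Y j) : IsLocallyEmpty T :=
  haveI := (hD.disjoint ι hι).coproductDisjoint Y
  hD.isLocallyEmpty_of_isInitial h0 (IsInitial.ofCoproductDisjoint hij) (pullback.lift a b hab)

theorem IsGeometricPretopos.mono_sigma_ι (Y : ι → D) [HasCoproduct Y] (i : ι) :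
    Mono (Sigma.ι Y i) :=
  haveI := (hD.disjoint ι hι).coproductDisjoint Y
  inferInstance

end Coproducts

/-! ### Filtered colimits as quotients of coproducts -/

variable {K : Type w} [SmallCategory K] (G : K ⥤ D)

/-- Generalized elements of a cocone come locally from the diagram, and two of them agree if and
only if they locally agree at some stage. -/
structure IsLocalColimit {G : K ⥤ D} (c : Cocone G) : Prop where
  surj : ∀ ⦃T : D⦄ (t : T ⟶ c.pt),
    Locally fun A (f : A ⟶ T) => ∃ (k : K) (a : A ⟶ G.obj k), a ≫ c.ι.app k = f ≫ t
  inj : ∀ ⦃T : D⦄ ⦃j k : K⦄ (a : T ⟶ G.obj j) (b : T ⟶ G.obj k), a ≫ c.ι.app j = b ≫ c.ι.app k →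
    Locally fun A (f : A ⟶ T) => ∃ (l : K) (p : j ⟶ l) (q : k ⟶ l),
      f ≫ a ≫ G.map p = f ≫ b ≫ G.map q

theorem IsLocalColimit.of_isColimit {G : K ⥤ D} {c c' : Cocone G} (h : IsLocalColimit c)
    (hc : IsColimit c) (hc' : IsColimit c') : IsLocalColimit c' where
  surj T t := by
    refine (h.surj (t ≫ hc'.desc c)).mono fun A f ⟨k, a, ha⟩ => ⟨k, a, ?_⟩
    have h1 : hc'.desc c ≫ hc.desc c' = 𝟙 _ := hc'.hom_ext (by simp)
    have := ha =≫ hc.desc c'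
    simpa [h1] using this
  inj T j k a b hab := h.inj a b (by simpa using hab =≫ hc'.desc c)

/-- Two generalized elements of `∐ G` come from generalized elements of `G` which agree at some
stage. -/
def StageRel [HasCoproduct G.obj] {T : D} (a b : T ⟶ ∐ G.obj) : Prop :=
  ∃ (j k l : K) (p : j ⟶ l) (q : k ⟶ l) (a' : T ⟶ G.obj j) (b' : T ⟶ G.obj k),
    a' ≫ Sigma.ι G.obj j = a ∧ b' ≫ Sigma.ι G.obj k = b ∧ a' ≫ G.map p = b' ≫ G.map q

omit [Regular D] in
variable {G} in
theorem StageRel.symm [HasCoproduct G.obj] {T : D} {a b : T ⟶ ∐ G.obj} (h : StageRel G a b) :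
    StageRel G b a :=
  let ⟨j, k, l, p, q, a', b', ha, hb, h⟩ := h
  ⟨k, j, l, q, p, b', a', hb, ha, h.symm⟩

omit [Regular D] in
variable {G} in
theorem StageRel.comp [HasCoproduct G.obj] {T T' : D} {a b : T ⟶ ∐ G.obj} (h : StageRel G a b)
    (f : T' ⟶ T) : StageRel G (f ≫ a) (f ≫ b) :=
  let ⟨j, k, l, p, q, a', b', ha, hb, h⟩ := h
  ⟨j, k, l, p, q, f ≫ a', f ≫ b', by simp [ha], by simp [hb], by simp [h]⟩

/-- The relation is the union, over all cospans `j ⟶ l ⟵ k`, of the images of the pullbacks of `G j`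
and `G k` over `G l`. The cardinal hypothesis bounds the number of cospans. -/
theorem StageRel.exists_subobject (hD : IsGeometricCategory lam D) [HasCoproduct G.obj]
    (hK' : Cardinal.mk (Σ j k l : K, (j ⟶ l) × (k ⟶ l)) < lam) :
    ∃ S : Subobject ((∐ G.obj) ⨯ (∐ G.obj)), ∀ ⦃T : D⦄ (a b : T ⟶ ∐ G.obj),
      S.Factors (prod.lift a b) ↔ Locally fun A (f : A ⟶ T) => StageRel G (f ≫ a) (f ≫ b) := by
  obtain ⟨S, hS, hS'⟩ := hD.exists_union hK' (X := (∐ G.obj) ⨯ (∐ G.obj))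
    (Y := fun i => pullback (G.map i.2.2.2.1) (G.map i.2.2.2.2))
    (fun i => prod.lift (pullback.fst _ _ ≫ Sigma.ι G.obj _) (pullback.snd _ _ ≫ Sigma.ι G.obj _))
  refine ⟨S, fun T a b => ⟨fun h => (hS' _ h).mono ?_, fun h => Locally.factors (h.mono ?_)⟩⟩
  · rintro A f ⟨⟨j, k, l, p, q⟩, h, hh⟩
    refine ⟨j, k, l, p, q, h ≫ pullback.fst _ _, h ≫ pullback.snd _ _, ?_, ?_, ?_⟩
    · simpa [prod.lift_fst] using hh =≫ prod.fst
    · simpa [prod.lift_snd] using hh =≫ prod.snd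
    · simp [pullback.condition]
  · rintro A f ⟨j, k, l, p, q, a', b', ha, hb, h⟩
    have := Subobject.factors_of_factors_right (pullback.lift a' b' h) (hS ⟨j, k, l, p, q⟩)
    have h1 := pullback.lift_fst_assoc a' b' h (Sigma.ι G.obj j)
    have h2 := pullback.lift_snd_assoc a' b' h (Sigma.ι G.obj k)
    convert! this using 1
    refine (prod.comp_lift _ _ _).trans (Eq.trans ?_ (prod.comp_lift _ _ _).symm)
    exact congrArg₂ prod.lift (ha.symm.trans h1.symm) (hb.symm.trans h2.symm)

section

variable [IsFiltered K] (hD : IsGeometricPretopos lam D) (h0 : 0 < lam) (hK : Cardinal.mk K < lam)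
include hD h0 hK

variable {G} in
-- The middle element comes with two representatives. In the same summand they are equal, and
-- filteredness merges the two stages. In different summands disjointness makes the domain locally
-- empty, and there is nothing to prove.
theorem StageRel.trans [HasCoproduct G.obj] {T : D} {a b c : T ⟶ ∐ G.obj}
    (h : StageRel G a b) (h' : StageRel G b c) :
    Locally fun A (f : A ⟶ T) => StageRel G (f ≫ a) (f ≫ c) := by
  obtain ⟨j, k, l, p, q, a', b', ha, hb, h⟩ := h
  obtain ⟨k', j', l', q', p', b'', c', hb', hc, h'⟩ := h'
  by_cases hk : k = k'
  · subst hk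
    have := hD.mono_sigma_ι hK G.obj k
    obtain rfl : b' = b'' := by rw [← cancel_mono (Sigma.ι G.obj k), hb, hb']
    obtain ⟨m, r, r', hr⟩ := IsFiltered.span q q'
    refine .of_forall fun A f => StageRel.comp ⟨j, j', m, p ≫ r, p' ≫ r', a', c', ha, hc, ?_⟩ f
    rw [G.map_comp, G.map_comp, reassoc_of% h, ← reassoc_of% h', ← G.map_comp, ← G.map_comp, hr]
  · exact hD.isLocallyEmpty_of_sigma hK h0 G.obj hk b' b'' (hb.trans hb'.symm) _

/-- The colimit is the coproduct modulo the local form of `StageRel`. Regularity of the quotient map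
gives local surjectivity. Effectiveness says that no further identifications occur, which is the
injectivity clause. -/
theorem IsGeometricPretopos.exists_isLocalColimit
    (hK' : Cardinal.mk (Σ j k l : K, (j ⟶ l) × (k ⟶ l)) < lam) :
    ∃ c : Cocone G, Nonempty (IsColimit c) ∧ IsLocalColimit c := by
  have := hD.hasCoproducts K hK
  obtain ⟨S, hS⟩ := StageRel.exists_subobject G hD.toIsGeometricCategory hK'
  let p : (S : D) ⟶ ∐ G.obj := S.arrow ≫ prod.fst
  let q : (S : D) ⟶ ∐ G.obj := S.arrow ≫ prod.snd
  have hpq : prod.lift p q = S.arrow := by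
    ext <;> simp [p, q, prod.lift_fst, prod.lift_snd]
  have lift : ∀ {T : D} (a b : T ⟶ ∐ G.obj), S.Factors (prod.lift a b) →
      ∃ r : T ⟶ (S : D), r ≫ p = a ∧ r ≫ q = b := fun a b h =>
    ⟨S.factorThru _ h, by simp [p, prod.lift_fst], by simp [q, prod.lift_snd]⟩
  have factors : ∀ {T : D} (r : T ⟶ (S : D)), S.Factors (prod.lift (r ≫ p) (r ≫ q)) := by
    intro T r
    rw [← prod.comp_lift, hpq]
    exact Subobject.factors_comp_arrow r
  have hequiv : IsInternalEquivalence p q := by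
    refine ⟨fun a b h1 h2 => ?_, ?_, ?_, fun a b hab => ?_⟩
    · rw [← cancel_mono S.arrow, ← hpq, prod.comp_lift, prod.comp_lift, h1, h2]
    · refine lift _ _ ((hS _ _).2 ?_)
      refine (hD.locally_lift_sigma hK G.obj (𝟙 _)).mono ?_
      rintro A f ⟨k, a, ha⟩
      exact ⟨k, k, k, 𝟙 k, 𝟙 k, a, a, ha, ha, rfl⟩
    · refine lift _ _ ((hS _ _).2 (((hS _ _).1 ?_).mono fun A f h => h.symm))
      simpa using factors (𝟙 _)
    · refine lift _ _ ((hS _ _).2 ?_)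
      have h1 := (hS _ _).1 (factors a)
      have h2 := (hS _ _).1 (factors b)
      rw [← hab] at h2
      refine h1.bind fun A f hf => (h2.pullback f).bind fun B g hg => ?_
      exact (StageRel.trans hD h0 hK (hf.comp g) (by simpa using hg)).mono
        fun E k hk => by simpa using hk
  obtain ⟨Q₀, f₀, hf₀⟩ := hD.effective p q hequiv
  have := Regular.hasCoequalizer_of_isKernelPair hf₀
  -- Effectiveness only gives some map `f₀` with this kernel pair. It factors through the
  -- coequalizer, which therefore has the same kernel pair.
  have hπ : IsKernelPair (coequalizer.π p q) p q :=
    IsKernelPair.cancel_right (f₂ := coequalizer.desc f₀ hf₀.w) (coequalizer.condition p q)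
      (by simpa using hf₀)
  have eq_of_locally : ∀ {T : D} (a b : T ⟶ ∐ G.obj),
      (Locally fun A (f : A ⟶ T) => StageRel G (f ≫ a) (f ≫ b)) →
      a ≫ coequalizer.π p q = b ≫ coequalizer.π p q := by
    intro T a b h
    obtain ⟨r, rfl, rfl⟩ := lift a b ((hS a b).2 h)
    exact (Category.assoc r p _).trans
      ((congrArg (r ≫ ·) hπ.w).trans (Category.assoc r q _).symm)
  let c : Cocone G :=
    { pt := coequalizer p q
      ι :=
        { app := fun k => Sigma.ι G.obj k ≫ coequalizer.π p q
          naturality := fun j k u => by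
            rw [← Category.assoc]
            refine (eq_of_locally _ _ (.of_forall fun A f => StageRel.comp ?_ f)).trans
              (Category.comp_id _).symm
            exact ⟨k, j, k, 𝟙 k, u, G.map u, 𝟙 _, rfl, Category.id_comp _, by simp⟩ } }
  refine ⟨c, ⟨?_⟩, ?_⟩
  · have hdesc : ∀ s : Cocone G, p ≫ Sigma.desc s.ι.app = q ≫ Sigma.desc s.ι.app := by
      intro s
      -- The universal related pair is itself locally related at some stage, where a cocone
      -- identifies the two elements.
      have := (hS p q).1 (by simpa using factors (𝟙 _))
      refine Locally.hom_ext (this.mono ?_)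
      rintro A f ⟨j, k, l, x, y, a, b, ha, hb, h⟩
      rw [← reassoc_of% ha, ← reassoc_of% hb]
      simpa using h =≫ s.ι.app l
    refine
      { desc := fun s => coequalizer.desc (Sigma.desc s.ι.app) (hdesc s)
        fac := fun s k => by simp [c]
        uniq := fun s m hm => ?_ }
    apply coequalizer.hom_ext
    ext k
    simpa [c] using hm k
  · refine ⟨fun T t => ?_, fun T j k a b hab => ?_⟩
    · refine (locally_lift_of_isRegularEpi (coequalizer.π p q) t).bind fun A f ⟨g, hg⟩ => ?_
      refine (hD.locally_lift_sigma hK G.obj g).mono fun B h ⟨k, a, ha⟩ => ⟨k, a, ?_⟩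
      simp [c, reassoc_of% ha, hg]
    · obtain ⟨r, hr, hr'⟩ := hπ.lift' (a ≫ Sigma.ι G.obj j) (b ≫ Sigma.ι G.obj k)
        (by simpa [c] using hab)
      have h := (hS _ _).1 (factors r)
      rw [hr, hr'] at h
      refine h.bind ?_
      -- The witnesses bring their own summands. Where these differ from `j` or `k`, disjointness
      -- makes the domain locally empty.
      rintro A f ⟨j', k', l, x, y, a', b', ha, hb, h⟩
      by_cases hj : j' = j
      · by_cases hk : k' = k
        · subst hj hk
          have := hD.mono_sigma_ι hK G.obj j'
          have := hD.mono_sigma_ι hK G.obj k'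
          have ha' : a' = f ≫ a := by rw [← cancel_mono (Sigma.ι G.obj j'), ha, Category.assoc]
          have hb' : b' = f ≫ b := by rw [← cancel_mono (Sigma.ι G.obj k'), hb, Category.assoc]
          subst ha' hb'
          exact .of_forall fun B g => ⟨l, x, y, by simpa using g ≫= h⟩
        · exact hD.isLocallyEmpty_of_sigma hK h0 G.obj hk b' (f ≫ b) (by simpa using hb) _
      · exact hD.isLocallyEmpty_of_sigma hK h0 G.obj hj a' (f ≫ a) (by simpa using ha) _

theorem IsGeometricPretopos.isLocalColimit
    (hK' : Cardinal.mk (Σ j k l : K, (j ⟶ l) × (k ⟶ l)) < lam) {c : Cocone G} (hc : IsColimit c) :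
    IsLocalColimit c :=
  let ⟨_, ⟨h⟩, h'⟩ := hD.exists_isLocalColimit G h0 hK hK'
  h'.of_isColimit h hc

theorem IsGeometricPretopos.hasColimit
    (hK' : Cardinal.mk (Σ j k l : K, (j ⟶ l) × (k ⟶ l)) < lam) : HasColimit G :=
  let ⟨c, ⟨h⟩, _⟩ := hD.exists_isLocalColimit G h0 hK hK'
  ⟨⟨c, h⟩⟩

end

end FilteredColimits

/-! ## Small products of regular epimorphisms -/

section Chains

variable {D : Type u} [Category.{v} D]

theorem effectiveEpiFamily_of_unique {B : D} {α : Type*} (X : α → D) (π : ∀ a, X a ⟶ B) (a : α)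
    (ha : ∀ b, b = a) (hπ : EffectiveEpi (π a)) : EffectiveEpiFamily X π :=
  let _ : Unique α := ⟨⟨a⟩, ha⟩
  EffectiveEpiFamily.reindex X π (Equiv.ofUnique Unit α)
    (inferInstanceAs (EffectiveEpiFamily (fun _ : Unit => X a) fun _ => π a))

theorem effectiveEpi_of_effectiveEpiFamily_const {A B : D} {α : Type*} [Unique α] (f : A ⟶ B)
    (h : EffectiveEpiFamily (fun _ : α => A) (fun _ => f)) : EffectiveEpi f :=
  (effectiveEpi_iff_effectiveEpiFamily f).2
    (EffectiveEpiFamily.reindex _ _ (Equiv.ofUnique α Unit) h)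

theorem isBoundedTree_of_linearOrder {lam κ : Cardinal.{w}} (P : Type w) [LinearOrder P]
    [OrderBot P] [WellFoundedLT P] (hlam : 1 < lam) (hP : Cardinal.mk P < κ) :
    IsBoundedTree lam κ P where
  wellFounded := inferInstance
  isChain _ := isChain_of_trichotomous _
  limit_unique p q _ h := by
    by_contra hne
    rcases lt_or_gt_of_ne hne with hlt | hlt
    · exact lt_irrefl p (by simpa using (h ▸ hlt : p ∈ Set.Iio p))
    · exact lt_irrefl q (by simpa using (h.symm ▸ hlt : q ∈ Set.Iio q))
  degree p := by
    refine lt_of_le_of_lt ?_ hlam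
    rw [Cardinal.le_one_iff_subsingleton]
    exact ⟨fun a b => Subtype.ext (a.2.unique_right b.2)⟩
  length b := (Cardinal.mk_set_le (b : Set P)).trans_lt hP

/-- A chain is a tree with one branch. With a top vertex, the limit along that branch is the value
at the top. -/
theorem IsTreeRegular.effectiveEpi_map {lam κ : Cardinal.{w}} (hD : IsTreeRegular lam κ D)
    (P : Type w) [LinearOrder P] [BoundedOrder P] [WellFoundedLT P] (hlam : 1 < lam)
    (hP : Cardinal.mk P < κ) (F : Pᵒᵖ ⥤ D) (hF : IsProperDiagram F) :
    EffectiveEpi (F.map (homOfLE (bot_le : (⊥ : P) ≤ ⊤)).op) := by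
  have hinit : ∀ b : Flag P, IsInitial (op (⟨⊤, b.top_mem⟩ : (b : Set P))) := fun b =>
    IsInitial.ofUniqueHom (fun q => (homOfLE (show q.unop.1 ≤ ⊤ from le_top)).op)
      fun _ _ => Subsingleton.elim _ _
  exact effectiveEpi_of_effectiveEpiFamily_const _
    (hD P (isBoundedTree_of_linearOrder P hlam hP) F hF fun b =>
      ⟨coneOfDiagramInitial (hinit b) _, limitOfDiagramInitial (hinit b) _⟩)

end Chains

/-! ### Diagrams on a chain that change value once -/

section Switch

variable {D : Type u} [Category.{v} D] {P : Type w} [LinearOrder P] {A X : D}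

/-- The diagram on a chain with value `A` above the threshold `s` and value `X` elsewhere. -/
def switchDiagram (f : A ⟶ X) (s : P) : Pᵒᵖ ⥤ D where
  obj p := (ComposableArrows.mk₁ f).obj (if s < p.unop then 0 else 1)
  map {p q} h := (ComposableArrows.mk₁ f).map (homOfLE (by
    have := leOfHom h.unop
    split_ifs with h1 h2
    · exact le_rfl
    · exact Fin.zero_le _
    · exact absurd (lt_of_lt_of_le ‹s < q.unop› this) h1
    · exact le_rfl))
  map_id _ := (ComposableArrows.mk₁ f).map_id _
  map_comp _ _ := (ComposableArrows.mk₁ f).map_comp (homOfLE _) (homOfLE _)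

theorem isIso_switchDiagram_map (f : A ⟶ X) (s : P) {p q : Pᵒᵖ} (h : p ⟶ q)
    (hs : s < p.unop → s < q.unop) : IsIso ((switchDiagram f s).map h) := by
  have h1 : (if s < q.unop then (0 : Fin 2) else 1) = if s < p.unop then 0 else 1 := by
    by_cases hq : s < q.unop
    · rw [if_pos hq, if_pos (hq.trans_le (leOfHom h.unop))]
    · rw [if_neg hq, if_neg fun hp => hq (hs hp)]
  have : IsIso (homOfLE h1.ge) := ⟨homOfLE h1.le, rfl, rfl⟩
  exact inferInstanceAs (IsIso ((ComposableArrows.mk₁ f).map (homOfLE h1.ge)))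

theorem isRegularEpi_mk₁_map (f : A ⟶ X) [IsRegularEpi f] :
    ∀ {x y : Fin 2} (g : x ⟶ y), IsRegularEpi ((ComposableArrows.mk₁ f).map g)
  | 0, 0, _ => inferInstanceAs (IsRegularEpi (𝟙 A))
  | 0, 1, _ => inferInstanceAs (IsRegularEpi f)
  | 1, 1, _ => inferInstanceAs (IsRegularEpi (𝟙 X))
  | 1, 0, g => absurd (leOfHom g) (by decide)

theorem isRegularEpi_switchDiagram_map (f : A ⟶ X) [IsRegularEpi f] (s : P) {p q : Pᵒᵖ} (h : p ⟶ q) :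
    IsRegularEpi ((switchDiagram f s).map h) := by
  dsimp only [switchDiagram]
  exact isRegularEpi_mk₁_map _ _

theorem exists_iso_mk₁_map (f : A ⟶ X) {x y : Fin 2} (hx : x = 0) (hy : y = 1) (g : x ⟶ y) :
    ∃ (e : A ≅ (ComposableArrows.mk₁ f).obj x) (e' : X ≅ (ComposableArrows.mk₁ f).obj y),
      e.hom ≫ (ComposableArrows.mk₁ f).map g = f ≫ e'.hom := by
  subst hx hy
  exact ⟨Iso.refl A, Iso.refl X, (Category.id_comp f).trans (Category.comp_id f).symm⟩

theorem exists_iso_switchDiagram_map (f : A ⟶ X) (s : P) {p q : Pᵒᵖ} (h : p ⟶ q)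
    (hp : s < p.unop) (hq : ¬ s < q.unop) :
    ∃ (e : A ≅ (switchDiagram f s).obj p) (e' : X ≅ (switchDiagram f s).obj q),
      e.hom ≫ (switchDiagram f s).map h = f ≫ e'.hom := by
  dsimp only [switchDiagram]
  exact exists_iso_mk₁_map _ (if_pos hp) (if_neg hq) _

end Switch

/-! ### Products of regular epimorphisms along a well-ordered chain -/

section Products

variable {D : Type u} [Category.{v} D]

theorem HasLimitsLT.hasProductsOfShape {κ : Cardinal.{w}} (hD : HasLimitsLT κ D) {ι : Type w}
    (hι : Cardinal.mk ι < κ) : HasProductsOfShape ι D := by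
  refine hD (Discrete ι) (lt_of_le_of_lt (Cardinal.mk_le_of_injective
    (f := fun a : Arrow (Discrete ι) => a.left.as) ?_) hι)
  rintro ⟨⟨a⟩, ⟨b⟩, f⟩ ⟨⟨a'⟩, ⟨b'⟩, f'⟩ (h : a = a')
  obtain rfl : a = b := Discrete.eq_of_hom f
  obtain rfl : a' = b' := Discrete.eq_of_hom f'
  subst h
  obtain rfl : f = f' := Subsingleton.elim _ _
  rfl

/-- The pointwise product of a family of switching diagrams. -/
noncomputable def piSwitchDiagram {ι : Type*} {P : Type w} [LinearOrder P] [HasProductsOfShape ι D]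
    {A X : ι → D} (f : ∀ i, A i ⟶ X i) (s : ι → P) : Pᵒᵖ ⥤ D where
  obj p := ∏ᶜ fun i => (switchDiagram (f i) (s i)).obj p
  map h := Limits.Pi.map fun i => (switchDiagram (f i) (s i)).map h
  map_id p := by ext; simp
  map_comp h h' := by ext; simp

/-- The projections of `piSwitchDiagram`. -/
noncomputable def piSwitchDiagram.π {ι : Type*} {P : Type w} [LinearOrder P]
    [HasProductsOfShape ι D] {A X : ι → D} (f : ∀ i, A i ⟶ X i) (s : ι → P) (i : ι) :
    piSwitchDiagram f s ⟶ switchDiagram (f i) (s i) where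
  app p := Pi.π (fun i => (switchDiagram (f i) (s i)).obj p) i
  naturality _ _ _ := by simp [piSwitchDiagram]

namespace piSwitchDiagram

variable {ι : Type*} {P : Type w} [LinearOrder P] [HasProductsOfShape ι D] {A X : ι → D}
  (f : ∀ i, A i ⟶ X i) (s : ι → P)

theorem hom_ext {T : D} {p : Pᵒᵖ} {a b : T ⟶ (piSwitchDiagram f s).obj p}
    (h : ∀ i, a ≫ (π f s i).app p = b ≫ (π f s i).app p) : a = b :=
  Pi.hom_ext _ _ h

theorem exists_lift {T : D} {p : Pᵒᵖ} (t : ∀ i, T ⟶ (switchDiagram (f i) (s i)).obj p) :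
    ∃ g : T ⟶ (piSwitchDiagram f s).obj p, ∀ i, g ≫ (π f s i).app p = t i :=
  ⟨Pi.lift t, fun i => Pi.lift_π t i⟩

end piSwitchDiagram

variable [Regular D]

/-- Only coordinate `j` needs a local lift. The others are lifted by inverses. -/
theorem isRegularEpi_piMap_of_isIso {ι : Type*} [HasProductsOfShape ι D] {A X : ι → D}
    (f : ∀ i, A i ⟶ X i) (j : ι) [IsRegularEpi (f j)] (hf : ∀ i, i ≠ j → IsIso (f i)) :
    IsRegularEpi (Limits.Pi.map f) := by
  classical
  refine isRegularEpi_of_locally _ ((locally_lift_of_isRegularEpi (f j) (Pi.π X j)).mono ?_)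
  rintro B t ⟨g, hg⟩
  have : ∀ i, ∃ h : B ⟶ A i, h ≫ f i = t ≫ Pi.π X i := fun i => by
    by_cases hi : i = j
    · subst hi
      exact ⟨g, hg⟩
    · have := hf i hi
      exact ⟨t ≫ Pi.π X i ≫ inv (f i), by simp⟩
  choose h hh using this
  exact ⟨Pi.lift h, by ext i; simp [hh]⟩

theorem isProperDiagram_piSwitchDiagram {ι : Type w} [LinearOrder ι] [WellFoundedLT ι]
    [OrderBot (WithTop ι)]
    [HasProductsOfShape ι D] {A X : ι → D} (f : ∀ i, A i ⟶ X i) [∀ i, IsRegularEpi (f i)] :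
    IsProperDiagram (piSwitchDiagram f fun i => (i : WithTop ι)) where
  covers p := by
    rintro ⟨q, hq⟩
    -- A vertex with a successor is some index `j`, and passing to the successor switches coordinate
    -- `j` only.
    obtain ⟨j, rfl⟩ := WithTop.ne_top_iff_exists.1 hq.lt.ne_top
    have : IsRegularEpi ((piSwitchDiagram f fun i => (i : WithTop ι)).map
        (homOfLE hq.le).op) := by
      have : IsRegularEpi ((switchDiagram (f j) (j : WithTop ι)).map (homOfLE hq.le).op) :=
        isRegularEpi_switchDiagram_map _ _ _
      refine isRegularEpi_piMap_of_isIso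
        (fun i => (switchDiagram (f i) (i : WithTop ι)).map (homOfLE hq.le).op) j fun i hi => ?_
      refine isIso_switchDiagram_map _ _ _ fun (h : (i : WithTop ι) < q) => ?_
      exact lt_of_le_of_ne (hq.le_of_lt h) (by simpa using hi)
    exact effectiveEpiFamily_of_unique _ _ ⟨q, hq⟩ (fun r => Subtype.ext (r.2.unique_right hq))
      (IsRegularEpi.getStruct _).effectiveEpi
  limits p hp := by
    -- Each coordinate is constant from some stage `q i < p` on: past its threshold if that lies
    -- below `p`, and at an arbitrary stage otherwise. The limit can thus be read off coordinatewise
    -- at the stages `q i`.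
    have : ∀ i : ι, ∃ q : Set.Iio p, (i : WithTop ι) < p → (i : WithTop ι) < q.1 := fun i => by
      by_cases hi : (i : WithTop ι) < p
      · obtain ⟨q, hq, hq'⟩ := hp.isSuccPrelimit.lt_iff_exists_lt.1 hi
        exact ⟨⟨q, hq⟩, fun _ => hq'⟩
      · obtain ⟨q, hq⟩ := not_isMin_iff.1 hp.not_isMin
        exact ⟨⟨q, hq⟩, fun h => absurd h hi⟩
    choose q hq using this
    let E (i : ι) := switchDiagram (f i) (i : WithTop ι)
    have hE : ∀ i, IsIso ((E i).map (homOfLE (q i).2.le).op) := fun i =>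
      isIso_switchDiagram_map _ _ _ (hq i)
    let pr (i : ι) := piSwitchDiagram.π f (fun i => (i : WithTop ι)) i
    let leg (s : Cone (restrictDiagram (piSwitchDiagram f fun i => (i : WithTop ι)) (Set.Iio p)))
      (i : ι) (r : Set.Iio p) : s.pt ⟶ (E i).obj (op r.1) := s.π.app (op r) ≫ (pr i).app (op r.1)
    have nat : ∀ s i {a b : Set.Iio p} (hab : a ≤ b),
        leg s i b ≫ (E i).map (homOfLE (show a.1 ≤ b.1 from hab)).op = leg s i a := by
      intro s i a b hab
      refine (Category.assoc _ _ _).trans ((congrArg (s.π.app (op b) ≫ ·)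
        ((pr i).naturality (homOfLE (show a.1 ≤ b.1 from hab)).op).symm).trans ?_)
      exact (Category.assoc _ _ _).symm.trans
        (congrArg (· ≫ (pr i).app (op a.1)) (s.w (homOfLE hab).op))
    have key : ∀ s i (r : Set.Iio p),
        leg s i (q i) ≫ inv ((E i).map (homOfLE (q i).2.le).op) ≫ (E i).map (homOfLE r.2.le).op =
          leg s i r := by
      intro s i r
      rcases le_total r (q i) with h | h
      · rw [← nat s i h]
        congr 1
        rw [IsIso.inv_comp_eq, ← Functor.map_comp]
        rfl
      · have hr : IsIso ((E i).map (homOfLE (show (q i).1 ≤ r.1 from h)).op) :=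
          isIso_switchDiagram_map _ _ _ fun h' => hq i (lt_trans h' r.2)
        rw [← cancel_mono ((E i).map (homOfLE (show (q i).1 ≤ r.1 from h)).op), nat s i h,
          Category.assoc, Category.assoc, ← Functor.map_comp]
        exact (congrArg (_ ≫ ·) (IsIso.inv_hom_id _)).trans (Category.comp_id _)
    choose l hl using fun s => piSwitchDiagram.exists_lift f (fun i => (i : WithTop ι))
      fun i => leg s i (q i) ≫ inv ((E i).map (homOfLE (q i).2.le).op)
    refine ⟨{ lift := l, fac := fun s r => ?_, uniq := fun s m hm => ?_ }⟩
    · refine piSwitchDiagram.hom_ext _ _ fun i => ?_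
      refine Eq.trans ?_ (key s i r.unop)
      refine (Category.assoc _ _ _).trans ?_
      refine (congrArg (l s ≫ ·) ((pr i).naturality (homOfLE r.unop.2.le).op)).trans ?_
      refine (Category.assoc _ _ _).symm.trans ?_
      exact (congrArg (· ≫ _) (hl s i)).trans (Category.assoc _ _ _)
    · refine piSwitchDiagram.hom_ext _ _ fun i => ?_
      refine Eq.trans ?_ (hl s i).symm
      refine (IsIso.eq_comp_inv _).2 ?_
      refine (Category.assoc _ _ _).trans ((congrArg (m ≫ ·)
        ((pr i).naturality (homOfLE (q i).2.le).op).symm).trans ?_)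
      exact (Category.assoc _ _ _).symm.trans (congrArg (· ≫ _) (hm (op (q i))))

/-- In an infinitary pretopos, products of fewer than `κ` regular epimorphisms are regular
epimorphisms. -/
theorem IsInfinitaryPretopos.isRegularEpi_piMap {lam κ : Cardinal.{w}}
    (hD : IsInfinitaryPretopos lam κ D) (hκ : Cardinal.aleph0 ≤ κ) (hκlam : κ ≤ lam)
    {ι : Type w} (hι : Cardinal.mk ι < κ) [HasProductsOfShape ι D]
    {A X : ι → D} (f : ∀ i, A i ⟶ X i) [∀ i, IsRegularEpi (f i)] :
    IsRegularEpi (Limits.Pi.map f) := by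
  -- After well-ordering `ι`, the chain `WithTop ι` replaces `X i` by `A i` one index at a time. No
  -- coordinate has switched at `⊥`, and the added top lies above every threshold, so all have
  -- switched there.
  obtain ⟨_, _⟩ := exists_wellFoundedLT ι
  let : BoundedOrder (WithTop ι) := { WellFoundedLT.toOrderBot (WithTop ι) with }
  have := hD.treeRegular.effectiveEpi_map (WithTop ι)
    (Cardinal.one_lt_aleph0.trans_le (hκ.trans hκlam))
    ((Cardinal.mk_option (α := ι)).trans_lt
      (Cardinal.add_lt_of_lt hκ hι (Cardinal.one_lt_aleph0.trans_le hκ)))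
    _ (isProperDiagram_piSwitchDiagram f)
  have : IsRegularEpi ((piSwitchDiagram f fun i => (i : WithTop ι)).map
    (homOfLE (bot_le : (⊥ : WithTop ι) ≤ ⊤)).op) := inferInstance
  have he : ∀ i, ∃ (e : A i ≅ (switchDiagram (f i) (i : WithTop ι)).obj (op ⊤))
      (e' : X i ≅ (switchDiagram (f i) (i : WithTop ι)).obj (op ⊥)),
      e.hom ≫ (switchDiagram (f i) (i : WithTop ι)).map
        (homOfLE (bot_le : (⊥ : WithTop ι) ≤ ⊤)).op = f i ≫ e'.hom := fun i =>
    exists_iso_switchDiagram_map _ _ _ (WithTop.coe_lt_top i) not_lt_bot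
  choose e e' he using he
  let pr (i : ι) := piSwitchDiagram.π f (fun i => (i : WithTop ι)) i
  obtain ⟨x, hx⟩ := piSwitchDiagram.exists_lift f (fun i => (i : WithTop ι)) (p := op ⊥)
    fun i => Pi.π X i ≫ (e' i).hom
  refine isRegularEpi_of_locally _ ((locally_lift_of_isRegularEpi ((piSwitchDiagram f
    fun i => (i : WithTop ι)).map (homOfLE (bot_le : (⊥ : WithTop ι) ≤ ⊤)).op) x).mono ?_)
  rintro B t ⟨g, hg⟩
  refine ⟨Pi.lift fun i => g ≫ (pr i).app _ ≫ (e i).inv, Pi.hom_ext _ _ fun i => ?_⟩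
  have h1 := hg =≫ (pr i).app _
  rw [Category.assoc, Category.assoc, (pr i).naturality, hx i] at h1
  have h3 : (e i).inv ≫ f i = (switchDiagram (f i) (i : WithTop ι)).map
      (homOfLE (bot_le : (⊥ : WithTop ι) ≤ ⊤)).op ≫ (e' i).inv := by
    rw [Iso.inv_comp_eq, ← Category.assoc, he, Category.assoc, Iso.hom_inv_id, Category.comp_id]
  simp only [Category.assoc, Limits.Pi.map_π, Pi.lift_π_assoc, h3]
  simpa using h1 =≫ (e' i).inv

end Products

/-! ## Generalized elements of ultraproducts -/

section UltraElements

variable {I : Type w} (U : Ultrafilter I) {D : Type u'} [Category.{v'} D] [Regular D]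

/-- A presentation of `Q` as the ultraproduct of `X` in terms of generalized elements: families of
generalized elements defined on a member of `U` give generalized elements of `Q`, locally each
generalized element arises this way, and two families have the same image if and only if locally
they agree on a member of `U`. -/
structure UltraPresentation (X : I → D) (Q : D) where
  /-- The generalized element defined by a family. -/
  elt : ∀ {T : D} (J : Set I), J ∈ U → (∀ i ∈ J, T ⟶ X i) → (T ⟶ Q)
  comp_elt : ∀ {T T' : D} (f : T' ⟶ T) (J : Set I) (hJ : J ∈ U) (x : ∀ i ∈ J, T ⟶ X i),
    f ≫ elt J hJ x = elt J hJ fun i hi => f ≫ x i hi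
  elt_restrict : ∀ {T : D} (J : Set I) (hJ : J ∈ U) (x : ∀ i ∈ J, T ⟶ X i) (L : Set I) (hL : L ∈ U)
    (h : L ⊆ J), elt L hL (fun i hi => x i (h hi)) = elt J hJ x
  surj : ∀ {T : D} (t : T ⟶ Q), Locally fun A (f : A ⟶ T) =>
    ∃ (J : Set I) (hJ : J ∈ U) (x : ∀ i ∈ J, A ⟶ X i), elt J hJ x = f ≫ t
  inj : ∀ {T : D} (J : Set I) (hJ : J ∈ U) (x : ∀ i ∈ J, T ⟶ X i) (K : Set I) (hK : K ∈ U)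
    (y : ∀ i ∈ K, T ⟶ X i), elt J hJ x = elt K hK y → Locally fun A (f : A ⟶ T) =>
      ∃ L ∈ U, ∀ i (hi : i ∈ J) (hi' : i ∈ K), i ∈ L → f ≫ x i hi = f ≫ y i hi'

namespace UltraPresentation

variable {U} {X X' : I → D} {Q Q' : D} (s : UltraPresentation U X Q) (s' : UltraPresentation U X' Q')

theorem elt_eq_elt {T : D} {J K L : Set I} (hJ : J ∈ U) (hK : K ∈ U) (hL : L ∈ U)
    {x : ∀ i ∈ J, T ⟶ X i} {y : ∀ i ∈ K, T ⟶ X i}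
    (h : ∀ i (hi : i ∈ J) (hi' : i ∈ K), i ∈ L → x i hi = y i hi') :
    s.elt J hJ x = s.elt K hK y := by
  have hM : J ∩ K ∩ L ∈ U := Filter.inter_mem (Filter.inter_mem hJ hK) hL
  rw [← s.elt_restrict J hJ x _ hM fun i hi => hi.1.1,
    ← s.elt_restrict K hK y _ hM fun i hi => hi.1.2]
  congr
  funext i hi
  exact h i hi.1.1 hi.1.2 hi.2

/-- The map `φ` is the map of ultraproducts induced by the maps `g i`. -/
def IsInduced (g : ∀ i, X i ⟶ X' i) (φ : Q ⟶ Q') : Prop :=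
  ∀ ⦃T : D⦄ (J : Set I) (hJ : J ∈ U) (x : ∀ i ∈ J, T ⟶ X i),
    s.elt J hJ x ≫ φ = s'.elt J hJ fun i hi => x i hi ≫ g i

variable {s s'}

/-- Families with equal images locally agree on a member of `U` after applying the `g i`, which can
be cancelled index by index. -/
theorem IsInduced.mono {g : ∀ i, X i ⟶ X' i} {φ : Q ⟶ Q'} (h : IsInduced s s' g φ)
    [∀ i, Mono (g i)] : Mono φ where
  right_cancellation {T} a b hab := by
    refine Locally.hom_ext ((s.surj a).bind ?_)
    rintro A f ⟨J, hJ, x, hx⟩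
    refine ((s.surj b).pullback f).bind ?_
    rintro B f' ⟨K, hK, y, hy⟩
    have h1 : s'.elt J hJ (fun i hi => f' ≫ x i hi ≫ g i) = s'.elt K hK fun i hi => y i hi ≫ g i := by
      rw [← s'.comp_elt f' J hJ fun i hi => x i hi ≫ g i, ← h, ← h, hx, hy]
      simp [hab]
    refine (s'.inj _ _ _ _ _ _ h1).mono ?_
    rintro E f'' ⟨L, hL, hxy⟩
    have h2 : f'' ≫ f' ≫ s.elt J hJ x = f'' ≫ s.elt K hK y := by
      rw [s.comp_elt, s.comp_elt, s.comp_elt]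
      refine s.elt_eq_elt hJ hK hL fun i hi hi' hL => ?_
      rw [← cancel_mono (g i)]
      simpa using hxy i hi hi' hL
    simpa [hx, hy] using h2

/-- A family on `J` is a single element of a product over `J`, so all its entries can be lifted over
one common cover through a product of fewer than `κ` regular epimorphisms. -/
theorem IsInduced.isRegularEpi {lam κ : Cardinal.{w}}
    (hD : IsInfinitaryPretopos lam κ D) (hκ : Cardinal.aleph0 ≤ κ) (hκlam : κ ≤ lam)
    (hI : Cardinal.mk I < κ) {g : ∀ i, X i ⟶ X' i} {φ : Q ⟶ Q'} (h : IsInduced s s' g φ)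
    [∀ i, IsRegularEpi (g i)] : IsRegularEpi φ := by
  refine isRegularEpi_of_locally φ ((s'.surj (𝟙 Q')).bind ?_)
  rintro A f ⟨J, hJ, x, hx⟩
  have hJκ : Cardinal.mk J < κ := (Cardinal.mk_set_le J).trans_lt hI
  have := hD.hasLimits.hasProductsOfShape hJκ
  have := hD.isRegularEpi_piMap hκ hκlam hJκ fun i : J => g i
  refine (locally_lift_of_isRegularEpi (Limits.Pi.map fun i : J => g i)
    (Pi.lift fun i : J => x i i.2)).mono ?_
  rintro B f' ⟨y, hy⟩
  refine ⟨s.elt J hJ fun i hi => y ≫ Pi.π (fun i : J => X i) ⟨i, hi⟩, ?_⟩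
  rw [h, ← Category.comp_id f, ← hx, s'.comp_elt]
  congr
  funext i hi
  have := hy =≫ Pi.π (fun i : J => X' i) ⟨i, hi⟩
  simpa using this

/-! ### Finite limits of ultraproducts of functors -/

section Functors

variable {C : Type u} [Category.{v} C] {F : I → C ⥤ D} {Φ : C ⥤ D}
  (s : ∀ c, UltraPresentation U (fun i => (F i).obj c) (Φ.obj c))
  (hs : ∀ {c c' : C} (h : c ⟶ c'), IsInduced (s c) (s c') (fun i => (F i).map h) (Φ.map h))

include hs in
-- For the terminal object and for pullbacks, the comparison map is shown to be a monomorphism with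
-- local lifts, hence an isomorphism. Finitely many equations between families hold together on an
-- intersection of members of `U`.
theorem preservesFiniteLimits [HasFiniteLimits C] [∀ i, PreservesFiniteLimits (F i)] :
    PreservesFiniteLimits Φ := by
  have h1 : PreservesLimit (Functor.empty.{0} C) Φ := by
    let t : ∀ i (T : D), T ⟶ (F i).obj (⊤_ C) := fun i T =>
      terminal.from T ≫ inv (terminalComparison (F i))
    have ht : ∀ i {T : D} (a b : T ⟶ (F i).obj (⊤_ C)), a = b := fun i T a b => by
      rw [← cancel_mono (terminalComparison (F i))]
      exact Subsingleton.elim _ _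
    have : Mono (terminalComparison Φ) := by
      refine ⟨fun {T} a b _ => Locally.hom_ext (((s _).surj a).bind ?_)⟩
      rintro A f ⟨J, hJ, x, hx⟩
      refine (((s _).surj b).pullback f).mono ?_
      rintro B f' ⟨K, hK, y, hy⟩
      rw [← hy, Category.assoc, ← hx, (s _).comp_elt]
      exact (s _).elt_eq_elt hJ hK Filter.univ_mem fun i _ _ _ => ht i _ _
    have := isIso_of_mono_of_locally (terminalComparison Φ) (.of_forall fun A f =>
      ⟨(s _).elt Set.univ Filter.univ_mem fun i _ => t i A, Subsingleton.elim _ _⟩)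
    exact PreservesTerminal.of_iso_comparison Φ
  have h2 : ∀ {a b c : C} (f : a ⟶ c) (g : b ⟶ c), PreservesLimit (cospan f g) Φ := by
    intro a b c f g
    have hF : ∀ i, IsPullback ((F i).map (pullback.fst f g)) ((F i).map (pullback.snd f g))
      ((F i).map f) ((F i).map g) := fun i => (IsPullback.of_hasPullback f g).map (F i)
    have : Mono (pullbackComparison Φ f g) := by
      refine ⟨fun {T} p q hpq => ?_⟩
      have hp1 : p ≫ Φ.map (pullback.fst f g) = q ≫ Φ.map (pullback.fst f g) := by
        simpa using hpq =≫ pullback.fst _ _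
      have hp2 : p ≫ Φ.map (pullback.snd f g) = q ≫ Φ.map (pullback.snd f g) := by
        simpa using hpq =≫ pullback.snd _ _
      refine Locally.hom_ext (((s _).surj p).bind ?_)
      rintro A k ⟨J, hJ, x, hx⟩
      refine (((s _).surj q).pullback k).bind ?_
      rintro B k' ⟨K, hK, y, hy⟩
      have hxy : ∀ {d : C} (r : pullback f g ⟶ d), p ≫ Φ.map r = q ≫ Φ.map r →
          Locally fun E (e : E ⟶ B) => ∃ L ∈ U, ∀ i (hi : i ∈ J) (hi' : i ∈ K), i ∈ L →
            e ≫ (k' ≫ x i hi) ≫ (F i).map r = e ≫ y i hi' ≫ (F i).map r := by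
        intro d r hr
        have : (s d).elt J hJ (fun i hi => (k' ≫ x i hi) ≫ (F i).map r) =
            (s d).elt K hK (fun i hi => y i hi ≫ (F i).map r) := by
          rw [← hs r J hJ fun i hi => k' ≫ x i hi, ← hs r, ← (s _).comp_elt, hx, hy]
          simp [hr]
        exact (s d).inj _ _ _ _ _ _ this
      refine (hxy _ hp1).bind ?_
      rintro E e ⟨L, hL, hLxy⟩
      refine ((hxy _ hp2).pullback e).mono ?_
      rintro E' e' ⟨M, hM, hMxy⟩
      have : e' ≫ e ≫ k' ≫ (s _).elt J hJ x = e' ≫ e ≫ (s _).elt K hK y := by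
        simp only [(s _).comp_elt]
        refine (s _).elt_eq_elt hJ hK (Filter.inter_mem hL hM) fun i hi hi' hi'' => ?_
        apply (hF i).hom_ext
        · simpa using e' ≫= hLxy i hi hi' hi''.1
        · simpa using hMxy i hi hi' hi''.2
      simpa [hx, hy] using this
    have := isIso_of_mono_of_locally (pullbackComparison Φ f g) (by
      refine ((s a).surj (pullback.fst (Φ.map f) (Φ.map g))).bind ?_
      rintro A k ⟨J, hJ, x, hx⟩
      refine (((s b).surj (pullback.snd (Φ.map f) (Φ.map g))).pullback k).bind ?_
      rintro B k' ⟨K, hK, y, hy⟩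
      have : (s c).elt J hJ (fun i hi => (k' ≫ x i hi) ≫ (F i).map f) =
          (s c).elt K hK (fun i hi => y i hi ≫ (F i).map g) := by
        rw [← hs f J hJ fun i hi => k' ≫ x i hi, ← hs g, ← (s _).comp_elt, hx, hy]
        simp [pullback.condition]
      refine ((s c).inj _ _ _ _ _ _ this).mono ?_
      rintro E e ⟨L, hL, hxy⟩
      -- On these indices both families are defined and agree over `c`, so they pair to elements of
      -- the pullback.
      have hM : J ∩ K ∩ L ∈ U := Filter.inter_mem (Filter.inter_mem hJ hK) hL
      refine ⟨(s _).elt (J ∩ K ∩ L) hM fun i hi => (hF i).lift (e ≫ k' ≫ x i hi.1.1)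
        (e ≫ y i hi.1.2) (by simpa using hxy i hi.1.1 hi.1.2 hi.2), ?_⟩
      apply pullback.hom_ext
      · rw [Category.assoc, pullbackComparison_comp_fst, hs]
        simp only [IsPullback.lift_fst]
        rw [(s a).elt_restrict J hJ (fun i hi => e ≫ k' ≫ x i hi) _ hM fun i hi => hi.1.1,
          ← (s a).comp_elt, ← (s a).comp_elt, hx]
        simp
      · rw [Category.assoc, pullbackComparison_comp_snd, hs]
        simp only [IsPullback.lift_snd]
        rw [(s b).elt_restrict K hK (fun i hi => e ≫ y i hi) _ hM fun i hi => hi.1.2,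
          ← (s b).comp_elt, hy]
        simp)
    exact PreservesPullback.of_iso_comparison Φ
  have : PreservesLimitsOfShape (Discrete.{0} PEmpty) Φ :=
    preservesLimitsOfShape_pempty_of_preservesTerminal Φ
  have : PreservesLimitsOfShape WalkingCospan Φ :=
    ⟨fun {K} => preservesLimit_of_iso_diagram Φ (diagramIsoCospan K).symm⟩
  exact preservesFiniteLimits_of_preservesTerminal_and_pullbacks Φ

end Functors

end UltraPresentation

end UltraElements

/-! ## Unions of subobjects in ultraproducts -/

section Unions

theorem Ultrafilter.exists_fiber_mem {I : Type*} (U : Ultrafilter I) {ι : Type*} [Finite ι]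
    {J : Set I} (hJ : J ∈ U) (f : J → ι) : ∃ k, {i | ∃ h : i ∈ J, f ⟨i, h⟩ = k} ∈ U := by
  have : (⋃ k ∈ (Set.univ : Set ι), {i | ∃ h : i ∈ J, f ⟨i, h⟩ = k}) ∈ U :=
    Filter.mem_of_superset hJ fun i hi => by simpa using hi
  simpa using (Ultrafilter.finite_biUnion_mem_iff Set.finite_univ).1 this

/-- The meet is the pullback of the product of the inclusions along the diagonal. -/
theorem exists_isGLB_subobject {D : Type u} [Category.{v} D] [HasFiniteLimits D] {ι : Type*}
    [HasProductsOfShape ι D] {X : D} (a : ι → Subobject X) : ∃ c, IsGLB (Set.range a) c := by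
  refine ⟨Subobject.mk (pullback.snd (Limits.Pi.map fun i => (a i).arrow) (Pi.lift fun _ => 𝟙 X)),
    ?_, fun b hb => ?_⟩
  · rintro _ ⟨i, rfl⟩
    refine Subobject.mk_le_of_comm (pullback.fst _ _ ≫ Pi.π _ i) ?_
    have := pullback.condition (f := Limits.Pi.map fun i => (a i).arrow)
      (g := Pi.lift fun _ => 𝟙 X) =≫ Pi.π _ i
    simpa using this
  · refine Subobject.le_mk_of_comm (pullback.lift
      (Pi.lift fun i => Subobject.ofLE b (a i) (hb ⟨i, rfl⟩)) b.arrow ?_)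
      (pullback.lift_snd _ _ _)
    ext i
    simp

variable {I : Type w} {U : Ultrafilter I} {D : Type u'} [Category.{v'} D] [Regular D]
  {lam κ : Cardinal.{w}}

/-- This is the disjunction step of Łoś's theorem. Pulled back to `T`, the union at each index
becomes everything. Distributivity then covers `T` by the meets attached to choice functions `J →
ι`. As `ι` is finite, each choice function is constant on a member of `U`. -/
theorem IsInfinitaryPretopos.locally_exists_factors (hD : IsInfinitaryPretopos lam κ D)
    (hκ : Cardinal.aleph0 ≤ κ) (hκlam : κ ≤ lam) (hpow : ∀ γ : Cardinal.{w}, γ < κ → 2 ^ γ < lam)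
    (hI : Cardinal.mk I < κ) {X : I → D} {ι : Type} [Finite ι] (a : ∀ i, ι → Subobject (X i))
    (s : ∀ i, Subobject (X i)) (has : ∀ i, IsLUB (Set.range (a i)) (s i)) {T : D} {J : Set I}
    (hJ : J ∈ U) (x : ∀ i ∈ J, T ⟶ X i) (hx : ∀ i hi, (s i).Factors (x i hi)) :
    Locally fun A (f : A ⟶ T) => ∃ k, ∃ L ∈ U, ∀ i (hi : i ∈ J), i ∈ L →
      (a i k).Factors (f ≫ x i hi) := by
  have hJκ : Cardinal.mk J < κ := (Cardinal.mk_set_le J).trans_lt hI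
  have := hD.hasLimits.hasProductsOfShape hJκ
  have hι : Cardinal.mk (ULift.{w} ι) < Cardinal.aleph0 := Cardinal.lt_aleph0_of_finite _
  have hcard : Cardinal.mk (J → ULift.{w} ι) < lam := by
    -- A function is determined by its graph, a subset of `J × ι`, and this product still has size
    -- below `κ`.
    refine lt_of_le_of_lt (Cardinal.mk_le_of_injective
      (f := fun f : J → ULift.{w} ι => {p : J × ULift.{w} ι | f p.1 = p.2}) fun f g h => ?_)
      ((Cardinal.mk_set (α := J × ULift.{w} ι)).trans_lt (hpow _ ?_))
    · funext j
      have : (j, f j) ∈ {p : J × ULift.{w} ι | g p.1 = p.2} :=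
        (Set.ext_iff.1 h (j, f j)).1 rfl
      exact this.symm
    · rw [Cardinal.mk_prod, Cardinal.lift_id, Cardinal.lift_id]
      exact Cardinal.mul_lt_of_lt hκ hJκ (hι.trans_le hκ)
  let a' (i : J) (k : ULift.{w} ι) : Subobject T := (Subobject.pullback (x i i.2)).obj (a i k.down)
  choose c hc using fun f : J → ULift.{w} ι => exists_isGLB_subobject fun i => a' i (f i)
  have ha' : ∀ i, IsLUB (Set.range (a' i)) ⊤ := fun i => by
    have h1 : IsLUB (Set.range fun k : ULift.{w} ι => a i k.down) (s i) := by
      convert! has i using 1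
      exact ULift.down_surjective.range_comp (a i)
    have h2 := hD.isLUB_pullback (x i i.2) _ (hι.trans_le (hκ.trans hκlam)) _ h1
    have h3 : (Subobject.pullback (x i i.2)).obj (s i) = ⊤ := by
      rw [← top_le_iff]
      apply Subobject.le_of_factors
      rw [Limits.pullback_factors_iff]
      exact Subobject.factors_of_factors_right _ (hx i i.2)
    rwa [h3] at h2
  have hlub := hD.distrib T J (fun _ => ULift.{w} ι) hJκ
    (fun _ => hι.trans_le (hκ.trans hκlam)) a' (fun _ => ⊤) ⊤ c ha'
    ⟨by rintro _ ⟨_, rfl⟩; exact le_rfl, fun _ _ => le_top⟩ hc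
  refine (hD.locally_of_isLUB hcard hlub (𝟙 T) (Subobject.top_factors _)).mono ?_
  rintro A f ⟨g, hg⟩
  obtain ⟨k, hk⟩ := U.exists_fiber_mem hJ g
  refine ⟨k.down, _, hk, ?_⟩
  rintro i hi ⟨_, hik⟩
  rw [Category.comp_id] at hg
  have := (Limits.pullback_factors_iff _ _ _).1
    (Subobject.factors_of_le f ((hc g).1 ⟨⟨i, hi⟩, rfl⟩) hg)
  simpa [hik] using this

namespace UltraPresentation

variable {C : Type u} [Category.{v} C] [HasFiniteLimits C] {F : I → C ⥤ D} {Φ : C ⥤ D}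
  (s : ∀ c, UltraPresentation U (fun i => (F i).obj c) (Φ.obj c))
  (hs : ∀ {c c' : C} (h : c ⟶ c'), IsInduced (s c) (s c') (fun i => (F i).map h) (Φ.map h))

include hs in
/-- An ultraproduct of coherent functors is coherent. -/
theorem isCoherentFunctor (hD : IsInfinitaryPretopos lam κ D)
    (hκ : Cardinal.aleph0 ≤ κ) (hκlam : κ ≤ lam) (hpow : ∀ γ : Cardinal.{w}, γ < κ → 2 ^ γ < lam)
    (hI : Cardinal.mk I < κ) (hF : ∀ i, IsCoherentFunctor (F i)) : IsCoherentFunctor Φ := by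
  have := fun i => (hF i).preservesFiniteLimits
  have hΦ := preservesFiniteLimits s hs
  refine ⟨hΦ, fun f hf => ?_, fun {X ι} _ a t hat => ⟨?_, fun b hb => ?_⟩⟩
  · have := fun i => (hF i).map_isRegularEpi f hf
    exact (hs f).isRegularEpi hD hκ hκlam hI
  · rintro _ ⟨k, rfl⟩
    refine Subobject.mk_le_mk_of_comm (Φ.map (Subobject.ofLE _ _ (hat.1 ⟨k, rfl⟩))) ?_
    rw [← Φ.map_comp, Subobject.ofLE_arrow]
  · have hb' : b.Factors (Φ.map t.arrow) := by
      refine Locally.factors (((s _).surj (𝟙 _)).bind ?_)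
      rintro A f ⟨J, hJ, x, hx⟩
      refine (hD.locally_exists_factors (U := U) hκ hκlam hpow hI _ _
        (fun i => (hF i).map_isLUB a t hat) hJ (fun i hi => x i hi ≫ (F i).map t.arrow)
        fun i hi => (Subobject.mk_factors_iff _ _).2 ⟨x i hi, rfl⟩).mono ?_
      rintro B g ⟨k, L, hL, hk⟩
      have hM : J ∩ L ∈ U := Filter.inter_mem hJ hL
      have hk' : ∀ i (hi : i ∈ J ∩ L), ∃ z : B ⟶ (F i).obj (a k : C),
          z ≫ (F i).map (a k).arrow = g ≫ x i hi.1 ≫ (F i).map t.arrow := fun i hi =>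
        (Subobject.mk_factors_iff _ _).1 (hk i hi.1 hi.2)
      choose z hz using hk'
      have h1 : (s _).elt _ hM z ≫ Φ.map (a k).arrow = (g ≫ f) ≫ Φ.map t.arrow := by
        rw [← Category.comp_id f, ← hx, hs, Category.assoc, hs, (s _).comp_elt,
          ← (s _).elt_restrict J hJ _ _ hM fun i hi => hi.1]
        congr
        funext i hi
        exact hz i hi
      rw [← h1]
      exact Subobject.factors_of_factors_right _ (Subobject.factors_of_le _ (hb ⟨k, rfl⟩)
        (Subobject.mk_factors_self _))
    exact Subobject.mk_le_of_comm (b.factorThru _ hb') (by simp)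

end UltraPresentation

end Unions

/-! ## Ultraproducts in infinitary pretoposes -/

section Comparison

variable {I : Type w} {U : Ultrafilter I} {D : Type u'} [Category.{v'} D] [Regular D]
  {lam κ : Cardinal.{w}}

theorem IsLocallyEmpty.of_hom {D : Type*} [Category D] [HasFiniteLimits D] {A T : D}
    (h : IsLocallyEmpty T) (f : A ⟶ T) : IsLocallyEmpty A :=
  fun _ => ((h fun _ _ => False).pullback f).mono fun _ _ => False.elim

/-- Primeness concerns subobjects of `1`, so the factors are replaced by their supports. The product
of the `V i` covers that of the supports, so an empty product forces an empty meet of supports. -/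
theorem ZeroIsPrime.exists_isLocallyEmpty (hprime : ZeroIsPrime κ D)
    (hD : IsInfinitaryPretopos lam κ D) (hκ : Cardinal.aleph0 ≤ κ) (hκlam : κ ≤ lam) {ι : Type w}
    (hι : Cardinal.mk ι < κ) [HasProductsOfShape ι D] (V : ι → D) (hV : IsLocallyEmpty (∏ᶜ V)) :
    ∃ i, IsLocallyEmpty (V i) := by
  let F i := Regular.strongEpiMonoFactorisation (terminal.from (V i))
  obtain ⟨c, hc⟩ := exists_isGLB_subobject fun i => Subobject.mk (F i).m
  have hempty : IsLocallyEmpty (c : D) := by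
    have := hD.isRegularEpi_piMap hκ hκlam hι fun i => (F i).e
    refine .of_locally ((locally_lift_of_isRegularEpi (Limits.Pi.map fun i => (F i).e)
      (Pi.lift fun i => Subobject.ofLEMk c (F i).m (hc.1 ⟨i, rfl⟩))).mono ?_)
    rintro A f ⟨g, -⟩
    exact hV.of_hom g
  obtain ⟨i, hi⟩ := hprime ι _ hι c hc fun m =>
    Subobject.le_of_factors (hempty.factors c.arrow m)
  exact ⟨i, hD.isLocallyEmpty_of_isBot (Cardinal.aleph0_pos.trans_le (hκ.trans hκlam)) hi
    (terminal.from (V i)) ((Subobject.mk_factors_iff _ _).2 ⟨(F i).e, (F i).fac⟩)⟩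

namespace UltraPresentation

variable {X A B : I → D} {Q QA QB : D} {s : UltraPresentation U X Q}
  {sA : UltraPresentation U A QA} {sB : UltraPresentation U B QB} {a : ∀ i, A i ⟶ X i}
  {b : ∀ i, B i ⟶ X i} {α : QA ⟶ Q} {β : QB ⟶ Q}
  [∀ i, Mono (a i)] [∀ i, Mono (b i)] [Mono α] [Mono β]

theorem mk_le_mk (hα : IsInduced sA s a α) (hβ : IsInduced sB s b β)
    (h : {i | Subobject.mk (a i) ≤ Subobject.mk (b i)} ∈ U) :
    Subobject.mk α ≤ Subobject.mk β := by
  obtain ⟨g, hg⟩ : ∃ g, g ≫ β = α := by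
    refine Locally.exists_lift ((sA.surj (𝟙 _)).mono ?_)
    rintro T f ⟨J, hJ, x, hx⟩
    have hL := Filter.inter_mem hJ h
    refine ⟨sB.elt _ hL fun i hi => x i hi.1 ≫ Subobject.ofMkLEMk _ _ hi.2, ?_⟩
    rw [← Category.comp_id f, ← hx, hβ, hα, ← s.elt_restrict J hJ _ _ hL fun i hi => hi.1]
    simp
  exact Subobject.mk_le_mk_of_comm g hg

/-- The projections from a product of witnesses `u i ≤ A i` disjoint from `B i` form a generic
element of `QA`. Its image in `QB` is locally a family in the `B i`. At an index where the two
families agree, it lies in an empty intersection. -/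
theorem mem_of_mk_le_mk (hα : IsInduced sA s a α) (hβ : IsInduced sB s b β)
    (hD : IsInfinitaryPretopos lam κ D) (hκ : Cardinal.aleph0 ≤ κ) (hκlam : κ ≤ lam)
    (hBool : WeaklyBoolean D) (hprime : ZeroIsPrime κ D) (hI : Cardinal.mk I < κ)
    (h : Subobject.mk α ≤ Subobject.mk β) :
    {i | Subobject.mk (a i) ≤ Subobject.mk (b i)} ∈ U := by
  by_contra hn
  have hJ := U.compl_mem_iff_notMem.2 hn
  set J := {i | Subobject.mk (a i) ≤ Subobject.mk (b i)}ᶜ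
  choose u hu hua hub using fun i : J =>
    (hBool (Subobject.mk (a i)) (Subobject.mk (b i))).resolve_left i.2
  have hJκ : Cardinal.mk J < κ := (Cardinal.mk_set_le J).trans_lt hI
  have := hD.hasLimits.hasProductsOfShape hJκ
  let V (i : J) : D := u i
  let x (i : I) (hi : i ∈ J) : ∏ᶜ V ⟶ A i := Pi.π V ⟨i, hi⟩ ≫ Subobject.ofLEMk _ _ (hua ⟨i, hi⟩)
  have hx : ∀ i hi, x i hi ≫ a i = Pi.π V ⟨i, hi⟩ ≫ (u ⟨i, hi⟩).arrow := fun i hi => by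
    simp [x, V]
  have hempty : IsLocallyEmpty (∏ᶜ V) := by
    refine .of_locally ((sB.surj (sA.elt J hJ x ≫ Subobject.ofMkLEMk _ _ h)).bind ?_)
    rintro T f ⟨K, hK, y, hy⟩
    have hxy : s.elt J hJ (fun i hi => f ≫ x i hi ≫ a i) = s.elt K hK fun i hi => y i hi ≫ b i := by
      rw [← hβ, hy, ← s.comp_elt f J hJ fun i hi => x i hi ≫ a i, ← hα]
      simp
    refine (s.inj _ _ _ _ _ _ hxy).mono ?_
    rintro T' f' ⟨L, hL, hxyL⟩
    -- A single common index is enough for the contradiction.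
    obtain ⟨i, ⟨hiJ, hiK⟩, hiL⟩ := U.nonempty_of_mem
      (Filter.inter_mem (Filter.inter_mem hJ hK) hL)
    refine hD.isLocallyEmpty_of_isBot (Cardinal.aleph0_pos.trans_le (hκ.trans hκlam)) (hub ⟨i, hiJ⟩)
      (f' ≫ f ≫ x i hiJ ≫ a i) ((Subobject.inf_factors _).2 ⟨?_, ?_⟩)
    · rw [hx, ← Category.assoc, ← Category.assoc]
      exact Subobject.factors_comp_arrow _
    · rw [hxyL i hiJ hiK hiL, ← Category.assoc]
      exact Subobject.factors_of_factors_right _ (Subobject.mk_factors_self _)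
  obtain ⟨i, hi⟩ := hprime.exists_isLocallyEmpty hD hκ hκlam hJκ V hempty
  exact hu i fun m => Subobject.le_of_factors (hi.factors _ m)

end UltraPresentation

end Comparison

/-! ### From local colimits of products to presentations -/

section Ultraproducts

variable {I : Type w} {U : Ultrafilter I} {D : Type u'} [Category.{v'} D] [Regular D]
  {lam κ : Cardinal.{w}}

instance (U : Ultrafilter I) : IsFiltered {J : Set I // J ∈ U}ᵒᵖ := by
  have : IsCodirectedOrder {J : Set I // J ∈ U} :=
    ⟨fun J K => ⟨⟨J.1 ∩ K.1, Filter.inter_mem J.2 K.2⟩, Set.inter_subset_left,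
      Set.inter_subset_right⟩⟩
  have : Nonempty {J : Set I // J ∈ U} := ⟨⟨Set.univ, Filter.univ_mem⟩⟩
  infer_instance

theorem Ultrafilter.mk_mem_op_lt (U : Ultrafilter I) (h : 2 ^ Cardinal.mk I < lam) :
    Cardinal.mk {J : Set I // J ∈ U}ᵒᵖ < lam := by
  rw [Cardinal.mk_congr (equivToOpposite (α := {J : Set I // J ∈ U})).symm]
  exact (Cardinal.mk_subtype_le _).trans_lt (Cardinal.mk_set.trans_lt h)

/-- Thinness makes a cospan determined by its three objects. -/
theorem Cardinal.mk_cospan_lt {K : Type w} [SmallCategory K] [Quiver.IsThin K]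
    (h0 : Cardinal.aleph0 ≤ lam) (hK : Cardinal.mk K < lam) :
    Cardinal.mk (Σ j k l : K, (j ⟶ l) × (k ⟶ l)) < lam := by
  refine lt_of_le_of_lt (Cardinal.mk_le_of_injective
    (f := fun x : Σ j k l : K, (j ⟶ l) × (k ⟶ l) => (x.1, x.2.1, x.2.2.1)) ?_)
    (b := Cardinal.mk (K × K × K)) ?_
  · rintro ⟨j, k, l, p, q⟩ ⟨j', k', l', p', q'⟩ h
    simp only [Prod.mk.injEq] at h
    obtain ⟨rfl, rfl, rfl⟩ := h
    obtain rfl : p = p' := Subsingleton.elim _ _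
    obtain rfl : q = q' := Subsingleton.elim _ _
    rfl
  · simp only [Cardinal.mk_prod, Cardinal.lift_id]
    exact Cardinal.mul_lt_of_lt h0 hK (Cardinal.mul_lt_of_lt h0 hK hK)

/-- Local filtered colimits of products over the members of an ultrafilter are ultraproducts. -/
noncomputable def UltraPresentation.ofIsLocalColimit {X : I → D} (H : {J : Set I // J ∈ U}ᵒᵖ ⥤ D)
    (c : Cocone H) (hc : IsLocalColimit c)
    (π : ∀ (J : {J : Set I // J ∈ U}) (i : J.1), H.obj (op J) ⟶ X i)
    (hπ : ∀ J, IsLimit (Fan.mk (H.obj (op J)) (π J)))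
    (nat : ∀ (J K : {J : Set I // J ∈ U}) (h : K ⟶ J) (i : K.1),
      H.map h.op ≫ π K i = π J ⟨i.1, leOfHom h i.2⟩) : UltraPresentation U X c.pt :=
  have hom_ext : ∀ (J) {T : D} {a b : T ⟶ H.obj (op J)}, (∀ i, a ≫ π J i = b ≫ π J i) → a = b :=
    fun J _ _ _ h => (hπ J).hom_ext fun i => h i.as
  have fac : ∀ (J : {J : Set I // J ∈ U}) {T : D} (x : ∀ i : J.1, T ⟶ X i) (i : J.1),
      (hπ J).lift (Fan.mk T x) ≫ π J i = x i :=
    fun J _ x i => (hπ J).fac (Fan.mk _ x) ⟨i⟩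
  { elt := fun {T} J hJ x =>
      (hπ ⟨J, hJ⟩).lift (Fan.mk T fun i : J => x i.1 i.2) ≫ c.ι.app (op ⟨J, hJ⟩)
    comp_elt := fun {T T'} f J hJ x => by
      rw [← Category.assoc]
      congr 1
      refine hom_ext _ fun i => ?_
      rw [Category.assoc, fac, fac]
    elt_restrict := fun {T} J hJ x L hL h => by
      rw [← c.w (homOfLE h : (⟨L, hL⟩ : {J : Set I // J ∈ U}) ⟶ ⟨J, hJ⟩).op, ← Category.assoc]
      congr 1
      refine hom_ext _ fun i => ?_
      rw [Category.assoc, nat _ _ _ i, fac, fac]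
    surj := fun {T} t => (hc.surj t).mono fun A f ⟨k, a, ha⟩ => by
      refine ⟨k.unop.1, k.unop.2, fun i hi => a ≫ π k.unop ⟨i, hi⟩, ?_⟩
      rw [← ha]
      congr 1
      exact hom_ext _ fun i => fac _ _ i
    inj := fun {T} J hJ x K hK y hxy => (hc.inj _ _ hxy).mono fun A f ⟨l, p, q, hpq⟩ => by
      refine ⟨l.unop.1, l.unop.2, fun i hi hi' hl => ?_⟩
      have h1 := nat _ _ p.unop ⟨i, hl⟩
      have h2 := nat _ _ q.unop ⟨i, hl⟩
      have := hpq =≫ π l.unop ⟨i, hl⟩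
      simp only [Category.assoc] at this
      erw [h1, h2, fac, fac] at this
      exact this }

theorem UltraPresentation.ofIsLocalColimit_isInduced {X X' : I → D}
    {H H' : {J : Set I // J ∈ U}ᵒᵖ ⥤ D} {c : Cocone H} {c' : Cocone H'}
    {hc : IsLocalColimit c} {hc' : IsLocalColimit c'}
    {π : ∀ (J : {J : Set I // J ∈ U}) (i : J.1), H.obj (op J) ⟶ X i}
    {π' : ∀ (J : {J : Set I // J ∈ U}) (i : J.1), H'.obj (op J) ⟶ X' i}
    {hπ : ∀ J, IsLimit (Fan.mk (H.obj (op J)) (π J))}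
    {hπ' : ∀ J, IsLimit (Fan.mk (H'.obj (op J)) (π' J))}
    {nat : ∀ (J K : {J : Set I // J ∈ U}) (h : K ⟶ J) (i : K.1),
      H.map h.op ≫ π K i = π J ⟨i.1, leOfHom h i.2⟩}
    {nat' : ∀ (J K : {J : Set I // J ∈ U}) (h : K ⟶ J) (i : K.1),
      H'.map h.op ≫ π' K i = π' J ⟨i.1, leOfHom h i.2⟩}
    {g : ∀ i, X i ⟶ X' i} (G : ∀ J, H.obj J ⟶ H'.obj J) (φ : c.pt ⟶ c'.pt)
    (hG : ∀ J i, G (op J) ≫ π' J i = π J i ≫ g i)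
    (hφ : ∀ J, c.ι.app J ≫ φ = G J ≫ c'.ι.app J) :
    IsInduced (ofIsLocalColimit H c hc π hπ nat) (ofIsLocalColimit H' c' hc' π' hπ' nat') g φ := by
  intro T J hJ x
  have hom_ext : ∀ (J) {T : D} {a b : T ⟶ H'.obj (op J)}, (∀ i, a ≫ π' J i = b ≫ π' J i) → a = b :=
    fun J _ _ _ h => (hπ' J).hom_ext fun i => h i.as
  refine (Category.assoc _ _ _).trans ?_
  rw [hφ, ← Category.assoc]
  refine congrArg (· ≫ _) (hom_ext _ fun i => ?_)
  refine (Category.assoc _ _ _).trans ?_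
  rw [hG, ← Category.assoc]
  refine (congrArg (· ≫ g i) ((hπ ⟨J, hJ⟩).fac (Fan.mk T fun i => x i.1 i.2) ⟨i⟩)).trans ?_
  exact ((hπ' ⟨J, hJ⟩).fac (Fan.mk T fun i => x i.1 i.2 ≫ g i) ⟨i⟩).symm

end Ultraproducts

/-! ### Presentations for objects and for functors -/

section Presentations

variable {I : Type w} {U : Ultrafilter I} {D : Type u'} [Category.{v'} D] [Regular D]
  {lam κ : Cardinal.{w}}

theorem IsGeometricPretopos.isLocalColimit_of_ultrafilter (hD : IsGeometricPretopos lam D)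
    (h0 : Cardinal.aleph0 ≤ lam) (hI : 2 ^ Cardinal.mk I < lam)
    {H : {J : Set I // J ∈ U}ᵒᵖ ⥤ D} {c : Cocone H} (hc : IsColimit c) : IsLocalColimit c :=
  hD.isLocalColimit H (Cardinal.aleph0_pos.trans_le h0) (U.mk_mem_op_lt hI)
    (Cardinal.mk_cospan_lt h0 (U.mk_mem_op_lt hI)) hc

theorem IsGeometricPretopos.hasColimitsOfShape_ultrafilter (hD : IsGeometricPretopos lam D)
    (h0 : Cardinal.aleph0 ≤ lam) (hI : 2 ^ Cardinal.mk I < lam) :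
    HasColimitsOfShape {J : Set I // J ∈ U}ᵒᵖ D :=
  ⟨fun H => hD.hasColimit H (Cardinal.aleph0_pos.trans_le h0) (U.mk_mem_op_lt hI)
    (Cardinal.mk_cospan_lt h0 (U.mk_mem_op_lt hI))⟩

/-- The presentation of ultraproducts of objects by generalized elements. -/
noncomputable def ultraproductPresentation (hD : IsGeometricPretopos lam D)
    (h0 : Cardinal.aleph0 ≤ lam) (hI : 2 ^ Cardinal.mk I < lam) [h : HasUltraproducts U D]
    (X : I → D) : UltraPresentation U X (ultraproduct U X) :=
  haveI := h.hasProducts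
  .ofIsLocalColimit (ultraproductDiagram U X) _
    (hD.isLocalColimit_of_ultrafilter h0 hI (colimit.isColimit (ultraproductDiagram U X)))
    (fun J i => Pi.π (fun i : J.1 => X i) i) (fun J => productIsProduct fun i : J.1 => X i)
    fun _ _ _ _ => Pi.lift_π _ _

theorem ultraproductMap_isInduced (hD : IsGeometricPretopos lam D)
    (h0 : Cardinal.aleph0 ≤ lam) (hI : 2 ^ Cardinal.mk I < lam) [h : HasUltraproducts U D]
    {X Y : I → D} (f : ∀ i, X i ⟶ Y i) :
    (ultraproductPresentation hD h0 hI X).IsInduced (ultraproductPresentation hD h0 hI Y) f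
      (ultraproductMap U f) :=
  haveI := h.hasProducts
  UltraPresentation.ofIsLocalColimit_isInduced
    (fun J => (ultraproductDiagramMap U f).app J) _
    (fun J i => Limits.Pi.map_π (fun i : J.1 => f i) i) fun _ => ι_colimMap _ _

variable {C : Type u} [Category.{v} C]

/-- The presentation of the values of ultraproducts of functors by generalized elements. -/
noncomputable def ultraproductFunctorPresentation (hD : IsGeometricPretopos lam D)
    (h0 : Cardinal.aleph0 ≤ lam) (hI : 2 ^ Cardinal.mk I < lam)
    [hDp : ∀ J : Set I, HasProductsOfShape J D] [h : HasUltraproducts U (C ⥤ D)]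
    (F : I → C ⥤ D) (c : C) :
    UltraPresentation U (fun i => (F i).obj c) ((ultraproduct U F).obj c) :=
  haveI := h.hasProducts
  haveI := hD.hasColimitsOfShape_ultrafilter (U := U) h0 hI
  .ofIsLocalColimit (ultraproductDiagram U F ⋙ (evaluation C D).obj c) _
    (hD.isLocalColimit_of_ultrafilter h0 hI (isColimitOfPreserves ((evaluation C D).obj c)
      (colimit.isColimit (ultraproductDiagram U F))))
    (fun J i => (Pi.π (fun i : J.1 => F i) i).app c)
    -- Evaluation preserves these products, but its values are products only through this limit
    -- cone, not by definition.
    (fun J => isLimitFanMkObjOfIsLimit ((evaluation C D).obj c) _ _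
      (productIsProduct fun i : J.1 => F i))
    fun J K h i => NatTrans.congr_app
      (show (ultraproductDiagram U F).map h.op ≫ Pi.π (fun i : K.1 => F i) i =
        Pi.π (fun i : J.1 => F i) ⟨i.1, leOfHom h i.2⟩ from Pi.lift_π _ i) c

theorem ultraproductFunctor_map_isInduced (hD : IsGeometricPretopos lam D)
    (h0 : Cardinal.aleph0 ≤ lam) (hI : 2 ^ Cardinal.mk I < lam)
    [hDp : ∀ J : Set I, HasProductsOfShape J D] [h : HasUltraproducts U (C ⥤ D)]
    (F : I → C ⥤ D) {c c' : C} (f : c ⟶ c') :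
    (ultraproductFunctorPresentation hD h0 hI F c).IsInduced
      (ultraproductFunctorPresentation hD h0 hI F c') (fun i => (F i).map f)
      ((ultraproduct U F).map f) :=
  haveI := h.hasProducts
  haveI := hD.hasColimitsOfShape_ultrafilter (U := U) h0 hI
  UltraPresentation.ofIsLocalColimit_isInduced
    (c := ((evaluation C D).obj c).mapCocone (colimit.cocone (ultraproductDiagram U F)))
    (c' := ((evaluation C D).obj c').mapCocone (colimit.cocone (ultraproductDiagram U F)))
    (fun J => ((ultraproductDiagram U F).obj J).map f) ((ultraproduct U F).map f)
    (fun J i => (Pi.π (fun i : J.1 => F i) i).naturality f)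
    fun J => ((colimit.ι (ultraproductDiagram U F) J).naturality f).symm

end Presentations

theorem mainTheorem4 (lam κ : Cardinal.{w}) (hlam : lam.IsRegular) (hκ : κ.IsRegular)
    (hκlam : κ ≤ lam) (hpow : ∀ γ : Cardinal.{w}, γ < κ → 2 ^ γ < lam)
    (D : Type u') [Category.{v'} D] [Regular D] (hD : IsInfinitaryPretopos lam κ D)
    (hBool : WeaklyBoolean D) (hprime : ZeroIsPrime κ D)
    (I : Type w) (hI : Cardinal.mk I < κ) (U : Ultrafilter I) :
    ∃ _ : HasUltraproducts U D,
      (∀ (C : Type u) [Category.{v} C] [Regular C], IsCoherentCategory C →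
        ∃ _ : HasUltraproducts U (C ⥤ D),
          ∀ F : I → C ⥤ D, (∀ i, IsCoherentFunctor (F i)) →
            IsCoherentFunctor (ultraproduct U F)) ∧
      (∀ (X A B : I → D) (a : ∀ i, A i ⟶ X i) (b : ∀ i, B i ⟶ X i)
        [∀ i, Mono (a i)] [∀ i, Mono (b i)],
        ∃ (_ : Mono (ultraproductMap U a)) (_ : Mono (ultraproductMap U b)),
          Subobject.mk (ultraproductMap U a) ≤ Subobject.mk (ultraproductMap U b) ↔
            {i | Subobject.mk (a i) ≤ Subobject.mk (b i)} ∈ U) := by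
  have h0 := hlam.aleph0_le
  have hP := hD.toIsGeometricPretopos
  have hprod : ∀ J : Set I, HasProductsOfShape J D := fun J =>
    hD.hasLimits.hasProductsOfShape ((Cardinal.mk_set_le J).trans_lt hI)
  have hcolim := hP.hasColimitsOfShape_ultrafilter (U := U) h0 (hpow _ hI)
  have hU : HasUltraproducts U D := ⟨hprod, fun _ => inferInstance⟩
  refine ⟨hU, fun C _ _ _ => ?_, fun X A B a b _ _ => ?_⟩
  -- Products and colimits of functors exist pointwise, from those of `D`.
  · have hUC : HasUltraproducts U (C ⥤ D) := ⟨fun _ => inferInstance, fun _ => inferInstance⟩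
    exact ⟨hUC, fun F hF => UltraPresentation.isCoherentFunctor _
      (ultraproductFunctor_map_isInduced hP h0 (hpow _ hI) F) hD hκ.aleph0_le hκlam hpow hI hF⟩
  · have hα := ultraproductMap_isInduced (U := U) hP h0 (hpow _ hI) a
    have hβ := ultraproductMap_isInduced (U := U) hP h0 (hpow _ hI) b
    have := hα.mono
    have := hβ.mono
    exact ⟨‹_›, ‹_›, UltraPresentation.mem_of_mk_le_mk hα hβ hD hκ.aleph0_le hκlam hBool hprime hI,
      UltraPresentation.mk_le_mk hα hβ⟩
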